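/- Let $X$ be a compact complex manifold and let $L\to X$ be a holomorphic line bundle with a smooth Hermitian metric $h_0$ whose Chern form $\omega_0$ is a Kähler form (so $X$ is projective). Write $|\cdot|$ for the norm on $L$ given by $h_0$ and for the induced norms on the powers $L^p=L^{\otimes p}$. Let $\mathrm{PSH}(X,\omega_0)$ be the set of functions $\psi:X\to[-\infty,\infty)$, $\psi\not\equiv-\infty$, that are locally the sum of a plurisubharmonic function and a smooth one and satisfy $dd^c\psi+\omega_0\ge 0$, where $dd^c=\frac{i}{\pi}\partial\bar\partial$. For $\alpha>0$, $\mathcal C^\alpha(X)$ is the usual space of functions of class $\mathcal C^k$, $k=\lfloor\alpha\rfloor$, whose derivatives of order $k$ are Hölder continuous with exponent $\alpha-k$ (no further condition if $\alpha=k$); for $K\subset X$ compact, $\mathcal C^\alpha(K)$ is the space of restrictions to $K$ of functions in $\mathcal C^\alpha(X)$, with the quotient norm. For $\phi:K\to\mathbb R$ continuous put $$\phi_K(z)=\sup\{\psi(z):\psi\in\mathrm{PSH}(X,\omega_0),\ \psi\le\phi\text{ on }K\}\qquad(z\in X),$$ and let $P_K\phi=\phi_K^*$ be the upper semicontinuous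 regularization of $\phi_K$. The set $K$ is *$(\mathcal C^\alpha,\mathcal C^{\alpha'})$-regular* if $\phi_K$ is upper semicontinuous for every $\phi\in\mathcal C^\alpha(K)$ and $P_K$ maps bounded subsets of $\mathcal C^\alpha(K)$ to bounded subsets of $\mathcal C^{\alpha'}(X)$ (in particular, $K$ is then not pluripolar). Let $K\subset X$ be a compact set, $W\subset K$ a compact subset, $\mu$ a Borel probability measure on $K$, and $\phi\in\mathcal C^\alpha(K)$, where $\alpha>0$. Assume that: 1. $K$ is $(\mathcal C^\alpha,\mathcal C^{\alpha'})$-regular for some $\alpha'>0$; 2. $W$ satisfies the maximum principle relatively to $(K,\phi)$, that is, $\sup_K(\psi-\phi)=\sup_W(\psi-\phi)$ for every $\psi\in\mathrm{PSH}(X,\omega_0)$; 3. $\mu$ satisfies the mass-density condition with respect to $W$, that is, there are constants $c>0$ and $\rho>0$ such that $\mu(B(x,r))\ge c\,r^\rho$ for all $x\in W$ and $0<r<1$, where $B(x,r)$ is the ball of centre $x$ and radius $r$ for the Riemannian distance on $X$ induced by $\omega_0$. Then $\mu$ is $1$-Bernstein–Markov with respect to $(K,\phi)$: for every $0<\delta<1$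 there is a constant $A>0$ such that $$\sup_K |s|e^{-p\phi}\ \le\ A\,e^{A p^{1-\delta}}\Big(\int_K |s|^2e^{-2p\phi}\,d\mu\Big)^{1/2}\qquad\text{for all } p\ge 1 \text{ and } s\in H^0(X,L^p).$$ -/

import Mathlib

open Set Filter Topology MeasureTheory Bundle
open scoped Manifold ContDiff TensorProduct ENNReal

noncomputable section

/-! Throughout, `X` is a complex manifold modelled on a finite-dimensional complex normed space `E`
and `L` is a holomorphic line bundle over `X` (a `C^ω` vector bundle with model fibre `ℂ`).
A chart into `E` is also a chart of the underlying real manifold, whose model is `𝓘(ℝ, E)`. -/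

namespace BernsteinMarkov

/-! ### Hölder classes `C^α` -/

section Holder

variable {E : Type*} [NormedAddCommGroup E] [NormedSpace ℂ E]
  {X : Type*} [TopologicalSpace X] [ChartedSpace E X]

/-- `S` is a bounded subset of `C^α(X)`, for `X` compact: locally in charts, the functions of `S`
are of class `C^k` with `k = ⌊α⌋`, their derivatives up to order `k` are uniformly bounded, and
their `k`-th derivatives are uniformly Hölder continuous with exponent `α - k ∈ [0, 1)`.
So for an integer `α` this is the usual class `C^k`. -/
def IsBoundedHolder (α : ℝ) (S : Set (X → ℝ)) : Prop :=
  ∀ x₀ : X, ∃ r > 0, ∃ M : ℝ,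
    Metric.ball (chartAt E x₀ x₀) r ⊆ (chartAt E x₀).target ∧
    ∀ f ∈ S,
      ContDiffOn ℝ ⌊α⌋₊ (f ∘ (chartAt E x₀).symm) (Metric.ball (chartAt E x₀ x₀) r) ∧
      (∀ j ≤ ⌊α⌋₊, ∀ z ∈ Metric.ball (chartAt E x₀ x₀) r,
        ‖iteratedFDeriv ℝ j (f ∘ (chartAt E x₀).symm) z‖ ≤ M) ∧
      ∀ z ∈ Metric.ball (chartAt E x₀ x₀) r, ∀ w ∈ Metric.ball (chartAt E x₀ x₀) r,
        ‖iteratedFDeriv ℝ ⌊α⌋₊ (f ∘ (chartAt E x₀).symm) z -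
          iteratedFDeriv ℝ ⌊α⌋₊ (f ∘ (chartAt E x₀).symm) w‖ ≤ M * ‖z - w‖ ^ (α - ⌊α⌋₊)

/-- `S` restricts to a bounded subset of `C^α(K)`, the space of restrictions to `K` of functions of
class `C^α` on `X`, with the quotient norm. Only the values of the functions on `K` matter. -/
def IsBoundedHolderOn (E : Type*) [NormedAddCommGroup E] [NormedSpace ℂ E] [ChartedSpace E X]
    (α : ℝ) (K : Set X) (S : Set (X → ℝ)) : Prop :=
  ∃ T : Set (X → ℝ), IsBoundedHolder (E := E) α T ∧ ∀ φ ∈ S, ∃ f ∈ T, EqOn φ f K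

/-- The restriction of `φ` to `K` belongs to `C^α(K)`. -/
def IsHolderOn (E : Type*) [NormedAddCommGroup E] [NormedSpace ℂ E] [ChartedSpace E X]
    (α : ℝ) (K : Set X) (φ : X → ℝ) : Prop :=
  IsBoundedHolderOn E α K {φ}

end Holder

/-! ### Plurisubharmonic functions and the operator `dd^c` in a vector space -/

section Local

variable {E : Type*} [NormedAddCommGroup E] [NormedSpace ℂ E]

/-- `f : E → [-∞, ∞)` is plurisubharmonic on the open set `U` (the constant `-∞` is allowed here):
it is upper semicontinuous, and its value at the centre of a closed complex disc in `U` is at most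
its mean over the boundary circle. As `f` is upper semicontinuous and `< ∞`, its mean (possibly
`-∞`) is the infimum of the means of the continuous functions that are `≥ f` on the circle. -/
def IsPshOn (f : E → EReal) (U : Set E) : Prop :=
  UpperSemicontinuousOn f U ∧ (∀ z ∈ U, f z ≠ ⊤) ∧
  ∀ z v : E, (∀ ζ : ℂ, ‖ζ‖ ≤ 1 → z + ζ • v ∈ U) →
    ∀ g : ℂ → ℝ, ContinuousOn g (Metric.sphere 0 1) →
      (∀ ζ ∈ Metric.sphere (0 : ℂ) 1, f (z + ζ • v) ≤ (g ζ : EReal)) →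
      f z ≤ ((Real.circleAverage g 0 1 : ℝ) : EReal)

/-- `(dd^c u)(v, i v)` at the point `z`, for `u` of class `C²`; here `dd^c = (i / π) ∂ ∂̄`, so that
`dd^c log |ζ|` is the Dirac mass at `0` in `ℂ`. -/
def ddc (u : E → ℝ) (z v : E) : ℝ :=
  (2 * Real.pi)⁻¹ * (iteratedFDeriv ℝ 2 u z ![v, v] +
    iteratedFDeriv ℝ 2 u z ![Complex.I • v, Complex.I • v])

end Local

/-! ### Hermitian line bundles -/

section LineBundle

variable {X : Type*} [TopologicalSpace X]
  (L : X → Type*) [∀ x, AddCommGroup (L x)] [∀ x, Module ℂ (L x)] [∀ x, TopologicalSpace (L x)]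
  [TopologicalSpace (TotalSpace ℂ L)] [FiberBundle ℂ L] [VectorBundle ℂ ℂ L]

/-- The holomorphic local frame of `L` given by the trivialization at `x₀`. -/
def frame (x₀ x : X) : L x := (trivializationAt ℂ L x₀).symm x 1

/-- The coordinate of a vector of the fibre of `L^p = L ⊗ ⋯ ⊗ L` at `x`, with respect to the
`p`-th tensor power of the local frame `frame L x₀`. -/
def coord (p : ℕ) (x₀ x : X) : (⨂[ℂ]^p (L x)) →ₗ[ℂ] ℂ :=
  PiTensorProduct.lift ((MultilinearMap.mkPiAlgebra ℂ (Fin p) ℂ).compLinearMap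
    fun _ => (trivializationAt ℂ L x₀).linearMapAt ℂ x)

/-- The section `s` of `L^p` is holomorphic, that is, `s ∈ H^0(X, L^p)`. -/
def IsHolomorphicSection (E : Type*) [NormedAddCommGroup E] [NormedSpace ℂ E] [ChartedSpace E X]
    {p : ℕ} (s : ∀ x, ⨂[ℂ]^p (L x)) : Prop :=
  ∀ x₀ : X, MDifferentiableOn 𝓘(ℂ, E) 𝓘(ℂ, ℂ) (fun x => coord L p x₀ x (s x))
    (trivializationAt ℂ L x₀).baseSet

/-- A smooth Hermitian metric on the line bundle `L`. -/
structure HermitianMetric (E : Type*) [NormedAddCommGroup E] [NormedSpace ℂ E]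
    [ChartedSpace E X] where
  /-- the Hermitian form on each fibre -/
  form : ∀ x, L x →ₗ⋆[ℂ] L x →ₗ[ℂ] ℂ
  conj_symm : ∀ x (v w : L x), star (form x v w) = form x w v
  pos : ∀ x (v : L x), v ≠ 0 → 0 < (form x v v).re
  smooth : ∀ x₀ : X, ContMDiffOn 𝓘(ℝ, E) 𝓘(ℝ, ℝ) ∞
    (fun x => (form x (frame L x₀ x) (frame L x₀ x)).re) (trivializationAt ℂ L x₀).baseSet

variable {L}

namespace HermitianMetric

variable {E : Type*} [NormedAddCommGroup E] [NormedSpace ℂ E] [ChartedSpace E X]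
  (h : HermitianMetric L E)

/-- The norm `|v|` of a vector of `L`. -/
def norm (x : X) (v : L x) : ℝ := √(h.form x v v).re

/-- The norm `|t|` of a vector of `L^p`, for the metric induced by `h`: if `t` is `c` times the
`p`-th tensor power of a nonzero vector `σ` of `L x`, then `|t| = |c| |σ|^p`. -/
def normPow (p : ℕ) (x : X) (t : ⨂[ℂ]^p (L x)) : ℝ :=
  ‖coord L p x x t‖ * h.norm x (frame L x x) ^ p

/-- The function `-log |σ|`, where `σ` is the local frame given by the trivialization at `x₀`, read
in the chart at `x₀`. It is a local potential of the Chern form: `ω₀ = dd^c (-log |σ|)`. -/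
def potential (x₀ : X) (z : E) : ℝ :=
  -Real.log (h.norm ((chartAt E x₀).symm z) (frame L x₀ ((chartAt E x₀).symm z)))

/-- The open set of `E` where the chart and the trivialization at `x₀` are both defined. -/
def chartDomain (L : X → Type*) [∀ x, AddCommGroup (L x)] [∀ x, Module ℂ (L x)]
    [∀ x, TopologicalSpace (L x)] [TopologicalSpace (TotalSpace ℂ L)] [FiberBundle ℂ L]
    (E : Type*) [NormedAddCommGroup E] [ChartedSpace E X] (x₀ : X) : Set E :=
  (chartAt E x₀).target ∩ (chartAt E x₀).symm ⁻¹' (trivializationAt ℂ L x₀).baseSet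

/-- The quadratic form `v ↦ ω₀(v, i v)` on the tangent space of `X` at `x`, where `ω₀` is the Chern
form of `h`. Tangent vectors at `x` are identified with elements of `E` by the chart at `x`. -/
def chernForm (x : X) (v : TangentSpace 𝓘(ℝ, E) x) : ℝ :=
  ddc (h.potential x) (chartAt E x x) (show E from v)

/-- The metric is positively curved: its Chern form `ω₀` is a Kähler form. -/
def IsPositive : Prop :=
  ∀ (x : X) (v : TangentSpace 𝓘(ℝ, E) x), v ≠ 0 → 0 < h.chernForm x v

/-- The distance on `X` of the Riemannian metric `v ↦ ω₀(v, i v)`: the infimum of the lengths of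
`C¹` paths (`∞` if there is no path). -/
def edist (x y : X) : ℝ≥0∞ :=
  letI : ∀ x : X, ENorm (TangentSpace 𝓘(ℝ, E) x) :=
    fun x => ⟨fun v => ENNReal.ofReal √(h.chernForm x v)⟩
  Manifold.riemannianEDist 𝓘(ℝ, E) x y

/-- The ball `B(x, r)` of `(X, ω₀)`. -/
def ball (x : X) (r : ℝ) : Set X := {y | h.edist x y < ENNReal.ofReal r}

/-- `ψ ∈ PSH(X, ω₀)`: the function `ψ : X → [-∞, ∞)` is not identically `-∞`, and `ψ + u` is
plurisubharmonic for each local potential `u` of `ω₀`, that is, `dd^c ψ + ω₀ ≥ 0`. -/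
def IsOmegaPsh (ψ : X → EReal) : Prop :=
  (∃ x, ψ x ≠ ⊥) ∧
  ∀ x₀ : X, IsPshOn (fun z => ψ ((chartAt E x₀).symm z) + (h.potential x₀ z : EReal))
    (chartDomain L E x₀)

/-! ### Equilibrium weights and regularity -/

/-- `φ_K = sup {ψ : ψ ∈ PSH(X, ω₀), ψ ≤ φ on K}`. -/
def extremal (K : Set X) (φ : X → ℝ) (z : X) : EReal :=
  ⨆ ψ ∈ {ψ : X → EReal | h.IsOmegaPsh ψ ∧ ∀ x ∈ K, ψ x ≤ (φ x : EReal)}, ψ z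

/-- The equilibrium weight `P_K φ = φ_K^*`, the upper semicontinuous regularization of `φ_K`. -/
def equilibrium (K : Set X) (φ : X → ℝ) (z : X) : EReal :=
  limsup (h.extremal K φ) (𝓝 z)

/-- `K` is `(C^α, C^α')`-regular: for every `φ ∈ C^α(K)` the function `φ_K` is upper
semicontinuous, and `P_K` sends bounded subsets of `C^α(K)` to bounded subsets of `C^α'(X)`.
In particular `P_K φ` is finite for `φ ∈ C^α(K)`, so that `K` is not pluripolar. -/
def IsRegular (α α' : ℝ) (K : Set X) : Prop :=
  (∀ φ : X → ℝ, IsHolderOn E α K φ → UpperSemicontinuous (h.extremal K φ)) ∧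
  ∀ S : Set (X → ℝ), IsBoundedHolderOn E α K S →
    ∃ T : Set (X → ℝ), IsBoundedHolder (E := E) α' T ∧
      ∀ φ ∈ S, ∃ g ∈ T, ∀ z, h.equilibrium K φ z = (g z : EReal)

/-- `W` satisfies the maximum principle relatively to `(K, φ)`. -/
def MaximumPrinciple (W K : Set X) (φ : X → ℝ) : Prop :=
  IsCompact W ∧ W ⊆ K ∧
  ∀ ψ : X → EReal, h.IsOmegaPsh ψ →
    ⨆ x ∈ K, (ψ x - (φ x : EReal)) = ⨆ x ∈ W, (ψ x - (φ x : EReal))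

/-! ### Measures -/

variable [MeasurableSpace X]

/-- `μ` satisfies the mass-density condition with respect to `W`. -/
def MassDensity (μ : Measure X) (W : Set X) : Prop :=
  ∃ c > (0 : ℝ), ∃ ρ > (0 : ℝ), ∀ x ∈ W, ∀ r : ℝ, 0 < r → r < 1 →
    ENNReal.ofReal (c * r ^ ρ) ≤ μ (h.ball x r)

/-- The norm `‖s‖_{L^∞(K, pφ)}`, where `|s|_{pφ} = |s| e^{-pφ}`. -/
def supNorm (K : Set X) (φ : X → ℝ) {p : ℕ} (s : ∀ x, ⨂[ℂ]^p (L x)) : ℝ :=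
  ⨆ x : K, h.normPow p x (s x) * Real.exp (-(p * φ x))

/-- The norm `‖s‖_{L^2(μ, pφ)}`, for a measure `μ` on `K`. -/
def l2Norm (K : Set X) (μ : Measure X) (φ : X → ℝ) {p : ℕ} (s : ∀ x, ⨂[ℂ]^p (L x)) : ℝ :=
  √(∫ x in K, (h.normPow p x (s x) * Real.exp (-(p * φ x))) ^ 2 ∂μ)

/-- The measure `μ` on `K` is `δ`-Bernstein-Markov with respect to `(K, φ)`. -/
def IsDeltaBernsteinMarkov (δ : ℝ) (K : Set X) (φ : X → ℝ) (μ : Measure X) : Prop :=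
  ∃ A > (0 : ℝ), ∀ p : ℕ, 1 ≤ p → ∀ s : ∀ x, ⨂[ℂ]^p (L x), IsHolomorphicSection L E s →
    h.supNorm K φ s ≤ A * Real.exp (A * (p : ℝ) ^ (1 - δ)) * h.l2Norm K μ φ s

/-- The measure `μ` on `K` is `1`-Bernstein-Markov with respect to `(K, φ)`. -/
def IsOneBernsteinMarkov (K : Set X) (φ : X → ℝ) (μ : Measure X) : Prop :=
  ∀ δ : ℝ, 0 < δ → δ < 1 → h.IsDeltaBernsteinMarkov δ K φ μ

end HermitianMetric

end LineBundle

end BernsteinMarkov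

end

/-! Let `M` be the supremum on `K` of `|s| e^{-pφ}`. If `M > 0`, then `(1/p) log (|s|/M)` is
`ω₀`-psh and at most `φ` on `K`, so it competes in the envelope. Hence `|s| ≤ M e^{pg}` on all of
`X`, where `g = P_K φ` (`normPow_le_exp_equilibrium`). Regularity makes `g` Hölder, and `g ≤ φ` on
`K`. The maximum principle, applied to the same function, gives a point `x ∈ W` where `|s| e^{-pφ} ≥
M/2` (`MaximumPrinciple.exists_half_le`).

In a local frame `s` is a holomorphic function `F`, and the potential of `ω₀` is added to the
weights. All weights are Hölder with exponent `β = min(α, α', 1)`, so on a ball of radius about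
`p^{-1/β}` their oscillation times `p` is bounded. There `|F|` is at most a constant times `|F(x)|`,
and the Schwarz lemma keeps `|F| ≥ |F(x)|/2` on a ball smaller by a fixed factor
(`quarter_le_norm_mul_exp`). Comparing the Riemannian distance with the charts gives `|s| e^{-pφ} ≥
bM` on `B(x, a p^{-1/β})`, with `φ` extended to `X` (`exists_ball_quarter_le`).

By mass density this ball has measure at least a constant times `p^{-ρ/β}`, so Chebyshev's
inequality yields `M ≤ A p^{ρ/(2β)} ‖s‖_{L²}`. This polynomial factor is absorbed by `exp (A
p^{1-δ})` for every `δ < 1`. -/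

set_option linter.unusedSectionVars false

noncomputable section

namespace BernsteinMarkov

/-! ### The operator `dd^c` -/

section Ddc

variable {E : Type*} [NormedAddCommGroup E] [NormedSpace ℂ E]
  {F : Type*} [NormedAddCommGroup F] [NormedSpace ℂ F]

/-- The term with the second derivative of `G` is complex quadratic in `w`, so it changes sign when
`w` becomes `i w`. This is what makes it cancel in `dd^c`. -/
lemma fderiv_fderiv_comp_apply {u : F → ℝ} {G : E → F} {z : E} (hu : ContDiffAt ℝ 2 u (G z))
    (hG : ContDiffAt ℂ 2 G z) (w : E) :
    fderiv ℝ (fderiv ℝ (u ∘ G)) z w w =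
      fderiv ℝ (fderiv ℝ u) (G z) (fderiv ℂ G z w) (fderiv ℂ G z w) +
        fderiv ℝ u (G z) (fderiv ℂ (fderiv ℂ G) z w w) := by
  have hGd : DifferentiableAt ℂ G z := hG.differentiableAt (by norm_num)
  have hGc : ContinuousAt G z := hGd.continuousAt
  have ev : (fun y => fderiv ℝ (u ∘ G) y w) =ᶠ[𝓝 z]
      fun y => fderiv ℝ u (G y) (fderiv ℂ G y w) := by
    filter_upwards [hGc.eventually (hu.eventually (by simp)), hG.eventually (by simp)] with y h1 h2
    have h3 : DifferentiableAt ℂ G y := h2.differentiableAt (by norm_num)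
    rw [fderiv_comp y (h1.differentiableAt (by norm_num)) (h3.restrictScalars ℝ),
      h3.fderiv_restrictScalars ℝ]
    rfl
  have hcomp : ContDiffAt ℝ 2 (u ∘ G) z := hu.comp z (hG.restrict_scalars ℝ)
  have h1 : DifferentiableAt ℝ (fderiv ℝ (u ∘ G)) z :=
    (hcomp.fderiv_right (m := 1) (by norm_num)).differentiableAt (by norm_num)
  have h2 : DifferentiableAt ℝ (fderiv ℝ u) (G z) :=
    (hu.fderiv_right (m := 1) (by norm_num)).differentiableAt (by norm_num)
  have h3 : DifferentiableAt ℂ (fderiv ℂ G) z :=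
    (hG.fderiv_right (m := 1) (by norm_num)).differentiableAt (by norm_num)
  have e1 : HasFDerivAt (fun y => fderiv ℝ (u ∘ G) y w)
      ((fderiv ℝ (fderiv ℝ (u ∘ G)) z).flip w) z := by
    simpa using h1.hasFDerivAt.clm_apply (hasFDerivAt_const w z)
  have e2 : HasFDerivAt (fun y => fderiv ℂ G y w) (((fderiv ℂ (fderiv ℂ G) z).flip w)) z := by
    simpa using h3.hasFDerivAt.clm_apply (hasFDerivAt_const w z)
  have e3 : HasFDerivAt (fun y => fderiv ℝ u (G y))
      ((fderiv ℝ (fderiv ℝ u) (G z)).comp ((fderiv ℂ G z).restrictScalars ℝ)) z :=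
    h2.hasFDerivAt.comp z (hGd.hasFDerivAt.restrictScalars ℝ)
  have e4 := e3.clm_apply (e2.restrictScalars ℝ)
  have e5 := (e1.congr_of_eventuallyEq ev.symm).unique e4
  have e6 := congrArg (fun l : E →L[ℝ] ℝ => l w) e5
  simpa [add_comm] using e6

/-- `dd^c` is invariant under holomorphic changes of variables. -/
lemma ddc_comp {u : F → ℝ} {G : E → F} {z : E} (hu : ContDiffAt ℝ 2 u (G z))
    (hG : ContDiffAt ℂ 2 G z) (v : E) :
    ddc (u ∘ G) z v = ddc u (G z) (fderiv ℂ G z v) := by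
  have h := fderiv_fderiv_comp_apply hu hG v
  have h' := fderiv_fderiv_comp_apply hu hG (Complex.I • v)
  simp only [map_smul, smul_apply, smul_smul, Complex.I_mul_I, neg_smul,
    one_smul, map_neg] at h'
  simp only [ddc, iteratedFDeriv_two_apply, Matrix.cons_val_zero, Matrix.cons_val_one, h, h']
  ring

lemma ddc_add {u w : E → ℝ} {z : E} (hu : ContDiffAt ℝ 2 u z) (hw : ContDiffAt ℝ 2 w z) (v : E) :
    ddc (u + w) z v = ddc u z v + ddc w z v := by
  simp only [ddc, iteratedFDeriv_add_apply (i := 2) hu hw, add_apply]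
  ring

lemma ddc_congr {u w : E → ℝ} {z : E} (h : u =ᶠ[𝓝 z] w) (v : E) : ddc u z v = ddc w z v := by
  simp only [ddc, iteratedFDeriv_two_apply, h.fderiv.fderiv_eq]

lemma contDiffAt_log_norm {τ : E → ℂ} {z : E} (hτ : ContDiffAt ℂ 2 τ z) (h0 : τ z ≠ 0) :
    ContDiffAt ℝ 2 (fun y => Real.log ‖τ y‖) z :=
  ((hτ.restrict_scalars ℝ).norm ℂ h0).log (norm_ne_zero_iff.2 h0)

/-- The logarithm of the modulus of a holomorphic function without zeros is pluriharmonic. -/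
lemma ddc_log_norm {τ : E → ℂ} {z : E} (hτ : ContDiffAt ℂ ω τ z) (h0 : τ z ≠ 0) (v : E) :
    ddc (fun y => Real.log ‖τ y‖) z v = 0 := by
  -- Restricting to the complex line through `z` in direction `v` reduces the claim to one variable,
  -- where `dd^c` is a multiple of the Laplacian and `log |τ|` is harmonic.
  have hG : ContDiff ℂ ω (fun ζ : ℂ => z + ζ • v) := by fun_prop
  have hz : z + (0 : ℂ) • v = z := by simp
  have h2 : ContDiffAt ℝ 2 (fun y => Real.log ‖τ y‖) z :=
    contDiffAt_log_norm (hτ.of_le le_top) h0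
  have hd : fderiv ℂ (fun ζ : ℂ => z + ζ • v) 0 1 = v := by
    have : HasFDerivAt (fun ζ : ℂ => z + ζ • v)
        ((ContinuousLinearMap.id ℂ ℂ).smulRight v) 0 :=
      ((hasFDerivAt_id (𝕜 := ℂ) (0 : ℂ)).smul_const v).const_add z
    rw [this.fderiv]; simp
  have h := ddc_comp (u := fun y => Real.log ‖τ y‖) (G := fun ζ : ℂ => z + ζ • v) (z := 0)
    (by simpa only [hz] using h2) (hG.contDiffAt.of_le le_top) 1
  rw [hd] at h
  simp only [hz] at h
  rw [← h]
  have han : AnalyticAt ℂ (fun ζ : ℂ => τ (z + ζ • v)) 0 := by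
    have : ContDiffAt ℂ ω (τ ∘ fun ζ : ℂ => z + ζ • v) 0 :=
      ContDiffAt.comp (0 : ℂ) (by simpa only [hz] using hτ) hG.contDiffAt
    exact this.analyticAt
  have hharm := (han.harmonicAt_log_norm (by simpa only [hz] using h0)).2.self_of_nhds
  have hlap := congrFun (InnerProductSpace.laplacian_eq_iteratedFDeriv_complexPlane
    (fun ζ : ℂ => Real.log ‖τ (z + ζ • v)‖)) 0
  simp only [Pi.zero_apply] at hharm
  rw [hharm] at hlap
  simp only [ddc, smul_eq_mul, mul_one]
  exact mul_eq_zero_of_right _ hlap.symm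

/-- For `u` of class `C²`, positivity of `dd^c u` at a point is uniform near that point. -/
lemma exists_ddc_lower_bound [FiniteDimensional ℂ E] {u : E → ℝ} {z₀ : E}
    (hu : ContDiffAt ℝ 2 u z₀) (hpos : ∀ v ≠ 0, 0 < ddc u z₀ v) :
    ∃ c > 0, ∀ᶠ z in 𝓝 z₀, ∀ v : E, c * ‖v‖ ^ 2 ≤ ddc u z v := by
  have hsmul : ∀ (z v : E) (t : ℝ), ddc u z (t • v) = t ^ 2 * ddc u z v := by
    intro z v t
    simp only [ddc, iteratedFDeriv_two_apply, Matrix.cons_val_zero, Matrix.cons_val_one, map_smul,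
      smul_comm Complex.I t v, smul_apply, smul_eq_mul]
    ring
  have hcont : ∀ v, ContinuousAt (fun q : E × E => ddc u q.1 q.2) (z₀, v) := by
    intro v
    have h1 : ContinuousAt (fderiv ℝ (fderiv ℝ u)) z₀ :=
      ((hu.fderiv_right (m := 1) (by norm_num)).fderiv_right (m := 0) (by norm_num)).continuousAt
    have h2 : ContinuousAt (fun q : E × E => fderiv ℝ (fderiv ℝ u) q.1) (z₀, v) :=
      ContinuousAt.comp (x := (z₀, v)) h1 continuousAt_fst
    simp only [ddc, iteratedFDeriv_two_apply, Matrix.cons_val_zero, Matrix.cons_val_one]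
    have h3 : ContinuousAt (fun q : E × E => q.2) (z₀, v) := continuousAt_snd
    have h4 : ContinuousAt (fun q : E × E => Complex.I • q.2) (z₀, v) := h3.const_smul _
    exact ((((h2.clm_apply h3).clm_apply h3).add ((h2.clm_apply h4).clm_apply h4))).const_mul _
  have : ProperSpace E := FiniteDimensional.proper ℂ E
  have hcomp : IsCompact (Metric.sphere (0 : E) 1) := isCompact_sphere 0 1
  -- Half the minimum over the unit sphere: the strict inequality survives a small move of the base
  -- point. If `E` is trivial the sphere is empty and any `c` will do.
  obtain ⟨c, hc, hcb⟩ : ∃ c > 0, ∀ v ∈ Metric.sphere (0 : E) 1, c < ddc u z₀ v := by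
    rcases (Metric.sphere (0 : E) 1).eq_empty_or_nonempty with h | h
    · exact ⟨1, one_pos, by simp [h]⟩
    · obtain ⟨v₁, hv₁, hmin⟩ := hcomp.exists_isMinOn h (f := ddc u z₀) (fun v _ =>
        (ContinuousAt.comp (g := fun q : E × E => ddc u q.1 q.2) (f := fun v => (z₀, v)) (x := v)
          (hcont v) (by fun_prop)).continuousWithinAt)
      have hv0 : v₁ ≠ 0 := by
        rintro rfl; simp at hv₁
      refine ⟨ddc u z₀ v₁ / 2, half_pos (hpos v₁ hv0), fun v hv => ?_⟩
      exact (half_lt_self (hpos v₁ hv0)).trans_le (hmin hv)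
  refine ⟨c, hc, ?_⟩
  have hev : ∀ᶠ z in 𝓝 z₀, ∀ v ∈ Metric.sphere (0 : E) 1, c < ddc u z v := by
    refine hcomp.eventually_forall_of_forall_eventually fun v hv => ?_
    exact (hcont v).eventually (lt_mem_nhds (hcb v hv))
  filter_upwards [hev] with z hz v
  rcases eq_or_ne v 0 with rfl | hv
  · have := hsmul z 0 0
    simp at this
    simp [this]
  · have hn : 0 < ‖v‖ := norm_pos_iff.2 hv
    have h1 := hz (‖v‖⁻¹ • v) (by
      rw [mem_sphere_zero_iff_norm, norm_smul, norm_inv, norm_norm, inv_mul_cancel₀ hn.ne'])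
    rw [hsmul, inv_pow, ← div_eq_inv_mul, lt_div_iff₀ (by positivity)] at h1
    exact h1.le

end Ddc

/-! ### Logarithms with values in `[-∞, ∞]` -/

/-- The logarithm of a nonnegative real number, with value `-∞` at `0`. -/
def elog (a : ℝ) : EReal := ENNReal.log (ENNReal.ofReal a)

lemma continuous_elog : Continuous elog :=
  ENNReal.continuous_log.comp ENNReal.continuous_ofReal

lemma elog_ne_top (a : ℝ) : elog a ≠ ⊤ :=
  fun h => ENNReal.ofReal_ne_top (ENNReal.log_eq_top_iff.1 h)

lemma coe_eq_elog (b : ℝ) : (b : EReal) = elog (Real.exp b) := by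
  rw [elog, ENNReal.log_ofReal_of_pos (Real.exp_pos b), Real.log_exp]

lemma elog_le_coe {a b : ℝ} : elog a ≤ b ↔ a ≤ Real.exp b := by
  rw [coe_eq_elog, elog, elog, ENNReal.log_le_log_iff, ENNReal.ofReal_le_ofReal_iff
    (Real.exp_pos b).le]

lemma elog_add_coe {a b : ℝ} (ha : 0 ≤ a) : elog a + b = elog (a * Real.exp b) := by
  rw [coe_eq_elog, elog, elog, elog, ← ENNReal.log_mul_add, ENNReal.ofReal_mul ha]

lemma elog_sub_coe {a b : ℝ} (ha : 0 ≤ a) : elog a - b = elog (a * Real.exp (-b)) := by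
  rw [← elog_add_coe ha, sub_eq_add_neg, EReal.coe_neg]

/-! ### Plurisubharmonicity of `log |F|` -/

/-- Jensen's formula: the defect is a sum over the zeros `u` in the disc of the multiplicity times
`log (1/|u|)`, and each term is nonnegative. -/
lemma log_norm_le_circleAverage {f : ℂ → ℂ} (hf : AnalyticOnNhd ℂ f (Metric.closedBall 0 1))
    (h0 : f 0 ≠ 0) : Real.log ‖f 0‖ ≤ Real.circleAverage (fun ζ => Real.log ‖f ζ‖) 0 1 := by
  have habs : |(1 : ℝ)| = 1 := abs_one
  rw [AnalyticOnNhd.circleAverage_log_norm one_ne_zero (by rwa [habs]) h0, habs]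
  refine le_add_of_nonneg_left (finsum_nonneg fun u => ?_)
  by_cases hu : u ∈ Metric.closedBall (0 : ℂ) 1
  · refine mul_nonneg ?_ ?_
    · exact_mod_cast (MeromorphicOn.AnalyticOnNhd.divisor_nonneg hf) u
    · rcases eq_or_ne u 0 with rfl | hu0
      · simp
      · have : 0 < ‖u‖ := norm_pos_iff.2 hu0
        simp only [zero_sub, norm_neg, one_mul]
        exact Real.log_nonneg ((one_le_inv₀ this).2 (by simpa using hu))
  · rw [Function.locallyFinsuppWithin.apply_eq_zero_of_notMem _ hu]
    simp

lemma eventually_ne_zero_codiscreteWithin_sphere {f : ℂ → ℂ}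
    (hf : AnalyticOnNhd ℂ f (Metric.closedBall 0 1)) (h0 : f 0 ≠ 0) :
    ∀ᶠ ζ in codiscreteWithin (Metric.sphere (0 : ℂ) |1|), f ζ ≠ 0 := by
  rw [abs_one]
  refine codiscreteWithin_mono Metric.sphere_subset_closedBall ?_
  rcases hf.eqOn_zero_or_eventually_ne_zero_of_preconnected
    (convex_closedBall (0 : ℂ) 1).isPreconnected with h | h
  · exact absurd (h (by simp)) h0
  · exact h

lemma isPshOn_elog_rpow_norm {E : Type*} [NormedAddCommGroup E] [NormedSpace ℂ E] {U : Set E}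
    (hU : IsOpen U) {F : E → ℂ} (hF : DifferentiableOn ℂ F U) {b c : ℝ} (hb : 0 < b)
    (hc : 0 < c) : IsPshOn (fun z => elog (b * ‖F z‖ ^ c)) U := by
  refine ⟨?_, fun z _ => elog_ne_top _, ?_⟩
  · refine ContinuousOn.upperSemicontinuousOn ?_
    refine continuous_elog.comp_continuousOn (continuousOn_const.mul ?_)
    exact hF.continuousOn.norm.rpow_const fun _ _ => Or.inr hc.le
  intro z v hz g hg hle
  rw [elog_le_coe]
  rcases eq_or_ne (F z) 0 with h0 | h0
  · simp only [h0, norm_zero, Real.zero_rpow hc.ne', mul_zero]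
    positivity
  set f : ℂ → ℂ := fun ζ => F (z + ζ • v) with hfdef
  have hf0 : f 0 = F z := by simp [f]
  have hopen : IsOpen ((fun ζ : ℂ => z + ζ • v) ⁻¹' U) := hU.preimage (by fun_prop)
  have hfd : DifferentiableOn ℂ f ((fun ζ : ℂ => z + ζ • v) ⁻¹' U) :=
    hF.comp (by fun_prop) (mapsTo_preimage _ _)
  have hfa : AnalyticOnNhd ℂ f (Metric.closedBall 0 1) :=
    (hfd.analyticOnNhd hopen).mono fun ζ hζ => hz ζ (by simpa using hζ)
  have hfz : f 0 ≠ 0 := by rwa [hf0]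
  have hmain := log_norm_le_circleAverage hfa hfz
  set k : ℂ → ℝ := fun ζ => (g ζ - Real.log b) / c with hk
  -- `Real.log 0 = 0` may exceed `k` at a zero of `f` on the circle. Zeros are isolated, so
  -- redefining the function there leaves its average unchanged.
  set l : ℂ → ℝ := fun ζ => if f ζ = 0 then k ζ else Real.log ‖f ζ‖ with hl
  have hgi : CircleIntegrable g 0 1 := by
    refine ContinuousOn.circleIntegrable zero_le_one hg
  have hki : CircleIntegrable k 0 1 := by
    refine ContinuousOn.circleIntegrable zero_le_one ?_
    exact (hg.sub continuousOn_const).div_const c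
  have hcongr : (fun ζ => Real.log ‖f ζ‖) =ᶠ[codiscreteWithin (Metric.sphere (0 : ℂ) |1|)] l := by
    filter_upwards [eventually_ne_zero_codiscreteWithin_sphere hfa hfz] with ζ hζ
    simp [l, hζ]
  have hli : CircleIntegrable l 0 1 :=
    CircleIntegrable.congr_codiscreteWithin hcongr
      (MeromorphicOn.circleIntegrable_log_norm
        (hfa.mono (by rw [abs_one]; exact Metric.sphere_subset_closedBall)).meromorphicOn)
  have hlk : Real.circleAverage l 0 1 ≤ Real.circleAverage k 0 1 := by
    refine Real.circleAverage_mono hli hki fun ζ hζ => ?_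
    rw [abs_one] at hζ
    by_cases h : f ζ = 0
    · simp [l, h]
    · simp only [l, h, if_false, k]
      have h1 := elog_le_coe.1 (hle ζ hζ)
      have hpos : 0 < ‖f ζ‖ := norm_pos_iff.2 h
      rw [← Real.log_le_iff_le_exp (by positivity), Real.log_mul hb.ne' (by positivity),
        Real.log_rpow hpos] at h1
      rw [le_div_iff₀ hc]
      linarith
  have hkg : Real.circleAverage k 0 1 = (Real.circleAverage g 0 1 - Real.log b) / c := by
    have : k = fun ζ => c⁻¹ • (g ζ - Real.log b) := by
      ext ζ; simp [k, div_eq_inv_mul]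
    rw [this, Real.circleAverage_fun_smul, Real.circleAverage_fun_sub hgi
      (circleIntegrable_const _ _ _), Real.circleAverage_const, smul_eq_mul, div_eq_inv_mul]
  rw [Real.circleAverage_congr_codiscreteWithin hcongr one_ne_zero, hf0] at hmain
  have h2 := hmain.trans (hlk.trans_eq hkg)
  rw [le_div_iff₀ hc] at h2
  have hpos : 0 < ‖F z‖ := norm_pos_iff.2 h0
  rw [← Real.log_le_iff_le_exp (by positivity), Real.log_mul hb.ne' (by positivity),
    Real.log_rpow hpos]
  linarith

lemma IsPshOn.congr {E : Type*} [NormedAddCommGroup E] [NormedSpace ℂ E] {U : Set E}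
    {f g : E → EReal} (hf : IsPshOn f U) (h : EqOn f g U) : IsPshOn g U := by
  refine ⟨fun z hz y hy => ?_, fun z hz => h hz ▸ hf.2.1 z hz, fun z v hzv a ha hle => ?_⟩
  · filter_upwards [hf.1 z hz y (by simpa only [h hz] using hy), self_mem_nhdsWithin] with w hw hwU
    rwa [← h hwU]
  · have hz : z ∈ U := by simpa using hzv 0 (by simp)
    rw [← h hz]
    refine hf.2.2 z v hzv a ha fun ζ hζ => ?_
    rw [h (hzv ζ (by simp at hζ; simp [hζ]))]
    exact hle ζ hζ

/-! ### Quantitative lower bounds for holomorphic functions -/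

/-- A holomorphic function bounded by `C |F(x)|` on a ball is at least `|F(x)| / 2` on a smaller
concentric ball. -/
lemma half_le_norm_of_norm_le {E : Type*} [NormedAddCommGroup E] [NormedSpace ℂ E] {F : E → ℂ}
    {x y : E} {r m B : ℝ} (hF : DifferentiableOn ℂ F (Metric.ball x r)) (hm : 0 < m)
    (hx : m ≤ ‖F x‖) (hB : ∀ w ∈ Metric.ball x r, ‖F w‖ ≤ B) (hr : 0 < r)
    (hy : ‖y - x‖ ≤ m / (4 * B) * r) : m / 2 ≤ ‖F y‖ := by
  have hxB : ‖F x‖ ≤ B := hB x (by simpa using hr)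
  have hBm : m ≤ B := hx.trans hxB
  have hBpos : 0 < B := hm.trans_le hBm
  have hyr : y ∈ Metric.ball x r := by
    rw [Metric.mem_ball, dist_eq_norm]
    refine hy.trans_lt ?_
    have : m / (4 * B) < 1 := by rw [div_lt_one (by positivity)]; linarith
    nlinarith
  -- Schwarz lemma: `F` maps the ball into the disc of radius `2B` about `F x`, so `m / (4B) * r` is
  -- the distance at which `F` can have moved by at most `m / 2`.
  have h := Complex.dist_le_div_mul_dist_of_mapsTo_ball (R₂ := 2 * B) hF (fun w hw => by
    rw [Metric.mem_closedBall, dist_eq_norm]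
    exact (norm_sub_le _ _).trans (by linarith [hB w hw])) hyr
  rw [dist_eq_norm, dist_eq_norm] at h
  have h1 : 2 * B / r * ‖y - x‖ ≤ m / 2 := by
    refine (mul_le_mul_of_nonneg_left hy (by positivity)).trans_eq ?_
    field_simp
    ring
  have h2 := norm_sub_norm_le (F x) (F y)
  rw [norm_sub_rev] at h2
  linarith

/-! ### Hölder functions in charts -/

section Holder

variable {E : Type*} [NormedAddCommGroup E] [NormedSpace ℂ E]
  {X : Type*} [TopologicalSpace X] [ChartedSpace E X]

lemma rpow_le_rpow_of_le_one_of_le {t a b : ℝ} (ht : 0 ≤ t) (ht1 : t ≤ 1) (hb : 0 < b)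
    (hba : b ≤ a) : t ^ a ≤ t ^ b := by
  rcases ht.eq_or_lt with rfl | h
  · rw [Real.zero_rpow hb.ne', Real.zero_rpow (hb.trans_le hba).ne']
  · exact Real.rpow_le_rpow_of_exponent_ge h ht1 hba

/-- Functions of class `C^α` are Hölder continuous with exponent `min α 1` in charts. -/
lemma IsBoundedHolder.exists_holder {α β : ℝ} {S : Set (X → ℝ)}
    (hS : IsBoundedHolder (E := E) α S) (hβ : 0 < β) (hβα : β ≤ α) (hβ1 : β ≤ 1) (x₀ : X) :
    ∃ r > 0, ∃ M : ℝ, 0 ≤ M ∧ Metric.ball (chartAt E x₀ x₀) r ⊆ (chartAt E x₀).target ∧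
      ∀ f ∈ S, ∀ z ∈ Metric.ball (chartAt E x₀ x₀) r, ∀ w ∈ Metric.ball (chartAt E x₀ x₀) r,
        |f ((chartAt E x₀).symm z) - f ((chartAt E x₀).symm w)| ≤ M * ‖z - w‖ ^ β := by
  obtain ⟨r, hr, M, hsub, hM⟩ := hS x₀
  set z₀ := chartAt E x₀ x₀
  -- Radius at most `1/2` keeps any two points at distance at most `1`, where lowering the exponent
  -- only increases the power.
  refine ⟨min r (1 / 2), by positivity, |M|, abs_nonneg M,
    (Metric.ball_subset_ball (min_le_left _ _)).trans hsub, fun f hf z hz w hw => ?_⟩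
  obtain ⟨hC, hb, hh⟩ := hM f hf
  have hz' : z ∈ Metric.ball z₀ r := Metric.ball_subset_ball (min_le_left _ _) hz
  have hw' : w ∈ Metric.ball z₀ r := Metric.ball_subset_ball (min_le_left _ _) hw
  have hzw : ‖z - w‖ ≤ 1 := by
    have h1 : dist z z₀ < 1 / 2 := (Metric.mem_ball.1 hz).trans_le (min_le_right _ _)
    have h2 : dist w z₀ < 1 / 2 := (Metric.mem_ball.1 hw).trans_le (min_le_right _ _)
    rw [← dist_eq_norm]
    linarith [dist_triangle_right z w z₀]
  -- For `⌊α⌋ = 0` the Hölder bound concerns the function itself; otherwise the bound on the first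
  -- derivative makes it Lipschitz on the convex ball.
  rcases Nat.eq_zero_or_pos ⌊α⌋₊ with h0 | h0
  · have := hh z hz' w hw'
    rw [h0] at this
    have e : ∀ y, iteratedFDeriv ℝ 0 (f ∘ (chartAt E x₀).symm) y =
      (continuousMultilinearCurryFin0 ℝ E ℝ).symm (f ((chartAt E x₀).symm y)) := fun y => rfl
    rw [e, e, ← map_sub, LinearIsometryEquiv.norm_map, Real.norm_eq_abs] at this
    refine this.trans ?_
    rw [Nat.cast_zero, sub_zero]
    refine mul_le_mul (le_abs_self M) (rpow_le_rpow_of_le_one_of_le (norm_nonneg _) hzw hβ hβα)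
      (by positivity) (abs_nonneg M)
  · have hd : ∀ y ∈ Metric.ball z₀ r, DifferentiableAt ℝ (f ∘ (chartAt E x₀).symm) y := by
      intro y hy
      refine ((hC y hy).contDiffAt (Metric.isOpen_ball.mem_nhds hy)).differentiableAt ?_
      exact_mod_cast h0.ne'
    have hbd : ∀ y ∈ Metric.ball z₀ r, ‖fderiv ℝ (f ∘ (chartAt E x₀).symm) y‖ ≤ |M| := by
      intro y hy
      rw [← norm_iteratedFDeriv_one]
      exact (hb 1 h0 y hy).trans (le_abs_self M)
    have := (convex_ball z₀ r).norm_image_sub_le_of_norm_fderiv_le hd hbd hw' hz'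
    rw [Real.norm_eq_abs] at this
    refine this.trans ?_
    refine mul_le_mul_of_nonneg_left ?_ (abs_nonneg M)
    simpa using rpow_le_rpow_of_le_one_of_le (norm_nonneg (z - w)) hzw hβ hβ1

lemma IsBoundedHolder.continuous {α : ℝ} {S : Set (X → ℝ)} (hS : IsBoundedHolder (E := E) α S)
    {f : X → ℝ} (hf : f ∈ S) : Continuous f := by
  refine continuous_iff_continuousAt.2 fun x₀ => ?_
  obtain ⟨r, hr, M, hsub, hM⟩ := hS x₀
  have h1 : ContinuousAt (f ∘ (chartAt E x₀).symm) (chartAt E x₀ x₀) :=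
    (hM f hf).1.continuousOn.continuousAt (Metric.ball_mem_nhds _ hr)
  have h2 : ContinuousAt ((f ∘ (chartAt E x₀).symm) ∘ chartAt E x₀) x₀ :=
    h1.comp ((chartAt E x₀).continuousAt (mem_chart_source E x₀))
  refine h2.congr ?_
  filter_upwards [chart_source_mem_nhds E x₀] with y hy
  simp [(chartAt E x₀).left_inv hy]

end Holder

/-! ### Complex manifolds as real manifolds, and charts -/

lemma contDiffOn_comp_chart_symm {𝕜 : Type*} [NontriviallyNormedField 𝕜]
    {E : Type*} [NormedAddCommGroup E] [NormedSpace 𝕜 E]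
    {X : Type*} [TopologicalSpace X] [ChartedSpace E X] {n : ℕ∞ω} [IsManifold 𝓘(𝕜, E) n X] {V : Type*} [NormedAddCommGroup V] [NormedSpace 𝕜 V]
    {f : X → V} {s : Set X} (hf : ContMDiffOn 𝓘(𝕜, E) 𝓘(𝕜, V) n f s) (x₀ : X) :
    ContDiffOn 𝕜 n (f ∘ (chartAt E x₀).symm)
      ((chartAt E x₀).target ∩ (chartAt E x₀).symm ⁻¹' s) := by
  rw [← contMDiffOn_iff_contDiffOn]
  exact hf.comp ((contMDiffOn_chart_symm (I := 𝓘(𝕜, E)) (x := x₀)).mono inter_subset_left)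
    fun z hz => hz.2

section Manifold

variable {E : Type*} [NormedAddCommGroup E] [NormedSpace ℂ E]
  {X : Type*} [TopologicalSpace X] [ChartedSpace E X]

/-- The real manifold underlying a complex manifold. -/
lemma isManifold_real [IsManifold 𝓘(ℂ, E) ω X] : IsManifold 𝓘(ℝ, E) ∞ X := by
  refine isManifold_of_contDiffOn _ _ _ fun e e' he he' => ?_
  have h := ModelWithCorners.contDiffOn_extendCoordChange (I := 𝓘(ℂ, E)) (n := ω) (M := X)
    (IsManifold.subset_maximalAtlas he) (IsManifold.subset_maximalAtlas he')
  have h' : ContDiffOn ℂ ω (e' ∘ e.symm) (e.symm ≫ₕ e').source := by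
    simpa [OpenPartialHomeomorph.extend] using h
  simpa using (h'.restrict_scalars ℝ).of_le le_top

lemma contDiffAt_chart_transition [IsManifold 𝓘(ℂ, E) ω X] {x₀ y : X}
    (hy : y ∈ (chartAt E x₀).source) :
    ContDiffAt ℂ ω (chartAt E x₀ ∘ (chartAt E y).symm) (chartAt E y y) := by
  have h := ModelWithCorners.contDiffOn_extendCoordChange (I := 𝓘(ℂ, E)) (n := ω) (M := X)
    (IsManifold.chart_mem_maximalAtlas y) (IsManifold.chart_mem_maximalAtlas x₀)
  have h' : ContDiffOn ℂ ω (chartAt E x₀ ∘ (chartAt E y).symm)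
      ((chartAt E y).symm ≫ₕ chartAt E x₀).source := by
    simpa [OpenPartialHomeomorph.extend] using h
  refine h'.contDiffAt (((chartAt E y).symm ≫ₕ chartAt E x₀).open_source.mem_nhds ?_)
  simp [hy]

lemma differentiableOn_comp_chart_symm [IsManifold 𝓘(ℂ, E) ω X] {V : Type*}
    [NormedAddCommGroup V] [NormedSpace ℂ V]
    {f : X → V} {s : Set X} (hf : MDifferentiableOn 𝓘(ℂ, E) 𝓘(ℂ, V) f s) (x₀ : X) :
    DifferentiableOn ℂ (f ∘ (chartAt E x₀).symm)
      ((chartAt E x₀).target ∩ (chartAt E x₀).symm ⁻¹' s) := by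
  rw [← mdifferentiableOn_iff_differentiableOn]
  have : ContMDiffOn 𝓘(ℂ, E) 𝓘(ℂ, E) ω (chartAt E x₀).symm (chartAt E x₀).target :=
    contMDiffOn_chart_symm (I := 𝓘(ℂ, E)) (x := x₀)
  exact hf.comp ((this.mdifferentiableOn (by simp)).mono inter_subset_left) fun z hz => hz.2

/-- The derivative at `y` of the chart at `x₀`, tangent vectors at `y` being identified with elements
of `E` by the chart at `y`. -/
def chartDeriv (x₀ y : X) : E →L[ℂ] E :=
  fderiv ℂ (chartAt E x₀ ∘ (chartAt E y).symm) (chartAt E y y)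

/-- Path lengths involve real derivatives, whereas the change of charts is differentiated over `ℂ`
to transform `dd^c`; the two agree after restriction of scalars. -/
lemma mfderiv_extChartAt_apply [IsManifold 𝓘(ℂ, E) ω X] {x₀ y : X}
    (hy : y ∈ (chartAt E x₀).source) (v : TangentSpace 𝓘(ℝ, E) y) :
    mfderiv 𝓘(ℝ, E) 𝓘(ℝ, E) (extChartAt 𝓘(ℝ, E) x₀) y v =
      chartDeriv x₀ y (show E from v) := by
  rw [chartDeriv]
  have : IsManifold 𝓘(ℝ, E) ∞ X := isManifold_real
  have : IsManifold 𝓘(ℝ, E) 1 X := IsManifold.of_le (n := ∞) (by norm_num)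
  have hd : MDifferentiableAt 𝓘(ℝ, E) 𝓘(ℝ, E) (extChartAt 𝓘(ℝ, E) x₀) y :=
    mdifferentiableAt_extChartAt hy
  rw [hd.mfderiv]
  have hG := (contDiffAt_chart_transition hy).differentiableAt (by simp)
  simp only [writtenInExtChartAt, extChartAt_model_space_eq_id, PartialEquiv.refl_coe,
    modelWithCornersSelf_coe, range_id, fderivWithin_univ, Function.id_comp]
  rw [← ContinuousLinearMap.coe_restrictScalars' (R := ℝ), ← hG.fderiv_restrictScalars ℝ]
  simp only [mfld_simps, extChartAt]
  rfl

end Manifold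

/-! ### Local frames -/

section Frames

variable {E : Type*} [NormedAddCommGroup E] [NormedSpace ℂ E]
  {X : Type*} [TopologicalSpace X]
  {L : X → Type*} [∀ x, AddCommGroup (L x)] [∀ x, Module ℂ (L x)] [∀ x, TopologicalSpace (L x)]
  [TopologicalSpace (TotalSpace ℂ L)] [FiberBundle ℂ L] [VectorBundle ℂ ℂ L]

variable (L) in
/-- The transition function from the frame at `x₀` to the frame at `y`. -/
def transition (x₀ y q : X) : ℂ := (trivializationAt ℂ L x₀).linearMapAt ℂ q (frame L y q)

lemma linearMapAt_frame {x₀ q : X} (hq : q ∈ (trivializationAt ℂ L x₀).baseSet) :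
    (trivializationAt ℂ L x₀).linearMapAt ℂ q (frame L x₀ q) = 1 :=
by
  have := (trivializationAt ℂ L x₀).linearMapAt_symmₗ (R := ℂ) hq 1
  rwa [Trivialization.coe_symmₗ _ hq] at this

lemma eq_linearMapAt_smul_frame {x₀ q : X} (hq : q ∈ (trivializationAt ℂ L x₀).baseSet)
    (v : L q) : v = (trivializationAt ℂ L x₀).linearMapAt ℂ q v • frame L x₀ q := by
  have h := (trivializationAt ℂ L x₀).symmₗ_linearMapAt (R := ℂ) hq v
  have h2 : ∀ c : ℂ, (trivializationAt ℂ L x₀).symmₗ ℂ q c = c • frame L x₀ q := by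
    intro c
    have := ((trivializationAt ℂ L x₀).symmₗ ℂ q).map_smul c 1
    rw [smul_eq_mul, mul_one] at this
    rw [this, Trivialization.coe_symmₗ _ hq, frame]
  rw [h2] at h
  exact h.symm

lemma frame_eq_smul {x₀ q : X} (hq : q ∈ (trivializationAt ℂ L x₀).baseSet) (y : X) :
    frame L y q = transition L x₀ y q • frame L x₀ q :=
  eq_linearMapAt_smul_frame hq _

lemma frame_ne_zero {x₀ q : X} (hq : q ∈ (trivializationAt ℂ L x₀).baseSet) :
    frame L x₀ q ≠ 0 := by
  intro h
  have := linearMapAt_frame hq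
  rw [h, map_zero] at this
  exact zero_ne_one this

lemma transition_ne_zero {x₀ y q : X} (hq : q ∈ (trivializationAt ℂ L x₀).baseSet)
    (hq' : q ∈ (trivializationAt ℂ L y).baseSet) : transition L x₀ y q ≠ 0 := by
  intro h
  have := frame_eq_smul hq y
  rw [h, zero_smul] at this
  exact frame_ne_zero hq' this

lemma contMDiffOn_transition [ChartedSpace E X] [ContMDiffVectorBundle ω ℂ L 𝓘(ℂ, E)] (x₀ y : X) :
    ContMDiffOn 𝓘(ℂ, E) 𝓘(ℂ, ℂ) ω (transition L x₀ y)
      ((trivializationAt ℂ L y).baseSet ∩ (trivializationAt ℂ L x₀).baseSet) := by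
  have h := contMDiffOn_coordChangeL (n := ω) (IB := 𝓘(ℂ, E)) (trivializationAt ℂ L y)
    (trivializationAt ℂ L x₀)
  have h1 := h.clm_apply (contMDiffOn_const (c := (1 : ℂ)))
  refine h1.congr fun q hq => ?_
  rw [ContinuousLinearEquiv.coe_coe,
    (trivializationAt ℂ L y).coordChangeL_apply (trivializationAt ℂ L x₀) hq]
  simp only [transition, frame]
  rw [Trivialization.coe_linearMapAt_of_mem _ hq.2]

end Frames

/-! ### Norms, potentials and the Chern form -/

namespace HermitianMetric

variable {E : Type*} [NormedAddCommGroup E] [NormedSpace ℂ E]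
  {X : Type*} [TopologicalSpace X] [ChartedSpace E X]
  {L : X → Type*} [∀ x, AddCommGroup (L x)] [∀ x, Module ℂ (L x)] [∀ x, TopologicalSpace (L x)]
  [TopologicalSpace (TotalSpace ℂ L)] [FiberBundle ℂ L] [VectorBundle ℂ ℂ L]
  (h : HermitianMetric L E)

lemma norm_smul (x : X) (c : ℂ) (v : L x) : h.norm x (c • v) = ‖c‖ * h.norm x v := by
  have : (h.form x (c • v) (c • v)).re = ‖c‖ ^ 2 * (h.form x v v).re := by
    rw [map_smul, map_smulₛₗ, LinearMap.smul_apply, smul_smul, smul_eq_mul, mul_comm c,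
      ← Complex.normSq_eq_conj_mul_self, Complex.re_ofReal_mul, Complex.normSq_eq_norm_sq]
  rw [norm, this, Real.sqrt_mul (by positivity), Real.sqrt_sq (norm_nonneg c), norm]

lemma norm_pos {x : X} {v : L x} (hv : v ≠ 0) : 0 < h.norm x v :=
  Real.sqrt_pos.2 (h.pos x v hv)

lemma isOpen_chartDomain (x₀ : X) : IsOpen (chartDomain L E x₀) :=
  (chartAt E x₀).isOpen_inter_preimage_symm (trivializationAt ℂ L x₀).open_baseSet

lemma chart_mem_chartDomain {x₀ y : X} (hy : y ∈ (chartAt E x₀).source)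
    (hy' : y ∈ (trivializationAt ℂ L x₀).baseSet) : chartAt E x₀ y ∈ chartDomain L E x₀ :=
  ⟨(chartAt E x₀).map_source hy, by simpa [(chartAt E x₀).left_inv hy] using hy'⟩

lemma chart_self_mem_chartDomain (x₀ : X) : chartAt E x₀ x₀ ∈ chartDomain L E x₀ :=
  chart_mem_chartDomain (mem_chart_source E x₀) (FiberBundle.mem_baseSet_trivializationAt' x₀)

lemma norm_frame_eq_exp_potential {x₀ : X} {z : E} (hz : z ∈ chartDomain L E x₀) :
    h.norm ((chartAt E x₀).symm z) (frame L x₀ ((chartAt E x₀).symm z)) =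
      Real.exp (-h.potential x₀ z) := by
  rw [potential, neg_neg, Real.exp_log (h.norm_pos (frame_ne_zero hz.2))]

lemma contDiffOn_potential [IsManifold 𝓘(ℂ, E) ω X] (x₀ : X) :
    ContDiffOn ℝ ∞ (h.potential x₀) (chartDomain L E x₀) := by
  have : IsManifold 𝓘(ℝ, E) ∞ X := isManifold_real
  have h1 := contDiffOn_comp_chart_symm (𝕜 := ℝ) (h.smooth x₀) x₀
  have hne : ∀ z ∈ chartDomain L E x₀, (h.form ((chartAt E x₀).symm z)
      (frame L x₀ ((chartAt E x₀).symm z)) (frame L x₀ ((chartAt E x₀).symm z))).re ≠ 0 :=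
    fun z hz => (h.pos _ _ (frame_ne_zero hz.2)).ne'
  exact (((h1.sqrt hne).log fun z hz => (Real.sqrt_pos.2 (h.pos _ _
    (frame_ne_zero hz.2))).ne')).neg

lemma contDiffAt_potential [IsManifold 𝓘(ℂ, E) ω X] {x₀ : X} {z : E}
    (hz : z ∈ chartDomain L E x₀) : ContDiffAt ℝ ∞ (h.potential x₀) z :=
  (h.contDiffOn_potential x₀).contDiffAt ((isOpen_chartDomain x₀).mem_nhds hz)

/-- The Chern form computed in the chart and with the potential at another point. -/
lemma chernForm_eq_ddc [IsManifold 𝓘(ℂ, E) ω X] [ContMDiffVectorBundle ω ℂ L 𝓘(ℂ, E)]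
    {x₀ y : X} (hy : y ∈ (chartAt E x₀).source)
    (hy' : y ∈ (trivializationAt ℂ L x₀).baseSet) (v : TangentSpace 𝓘(ℝ, E) y) :
    h.chernForm y v = ddc (h.potential x₀) (chartAt E x₀ y)
      (chartDeriv x₀ y (show E from v)) := by
  rw [chartDeriv, chernForm]
  set G : E → E := chartAt E x₀ ∘ (chartAt E y).symm with hG
  set z := chartAt E y y with hz
  have hGz : G z = chartAt E x₀ y := by simp [G, z]
  have hGc : ContDiffAt ℂ ω G z := contDiffAt_chart_transition hy
  have hzd : z ∈ chartDomain L E y := chart_self_mem_chartDomain y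
  set τ : E → ℂ := transition L x₀ y ∘ (chartAt E y).symm with hτ
  have hτc : ContDiffAt ℂ ω τ z := by
    refine (contDiffOn_comp_chart_symm (contMDiffOn_transition x₀ y) y).contDiffAt ?_
    refine ((chartAt E y).isOpen_inter_preimage_symm ((trivializationAt ℂ L y).open_baseSet.inter
      (trivializationAt ℂ L x₀).open_baseSet)).mem_nhds ?_
    refine ⟨hzd.1, hzd.2, ?_⟩
    simpa [z] using hy'
  have hτ0 : τ z ≠ 0 := by
    refine transition_ne_zero ?_ hzd.2
    simpa [z] using hy'
  have hcont : ContinuousAt (chartAt E y).symm z := (chartAt E y).symm.continuousAt hzd.1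
  have hsz : (chartAt E y).symm z = y := by simp [z]
  have e1 : ∀ᶠ w in 𝓝 z, (chartAt E y).symm w ∈ (chartAt E x₀).source :=
    hcont.eventually (by rw [hsz]; exact (chartAt E x₀).open_source.mem_nhds hy)
  have e2 : ∀ᶠ w in 𝓝 z, (chartAt E y).symm w ∈ (trivializationAt ℂ L x₀).baseSet :=
    hcont.eventually (by rw [hsz]; exact (trivializationAt ℂ L x₀).open_baseSet.mem_nhds hy')
  have e3 : ∀ᶠ w in 𝓝 z, (chartAt E y).symm w ∈ (trivializationAt ℂ L y).baseSet :=
    hcont.eventually ((trivializationAt ℂ L y).open_baseSet.mem_nhds hzd.2)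
  -- Two local potentials differ by the logarithm of the modulus of a nonvanishing holomorphic
  -- transition function, which `dd^c` kills.
  have hpot : h.potential x₀ ∘ G =ᶠ[𝓝 z] h.potential y + fun w => Real.log ‖τ w‖ := by
    filter_upwards [e1, e2, e3] with w h1 h2 h3
    have hGw : (chartAt E x₀).symm (G w) = (chartAt E y).symm w := by
      simp [G, (chartAt E x₀).left_inv h1]
    simp only [Pi.add_apply]
    rw [Function.comp_apply, potential, potential, hGw]
    have h4 : ‖τ w‖ ≠ 0 := norm_ne_zero_iff.2 (transition_ne_zero h2 h3)
    have h5 := (h.norm_pos (frame_ne_zero h2)).ne'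
    rw [frame_eq_smul h2 y, norm_smul]
    change _ = -Real.log (‖τ w‖ * _) + _
    rw [Real.log_mul h4 h5]
    ring
  have h1 : ContDiffAt ℝ 2 (h.potential x₀) (G z) := by
    rw [hGz]
    exact (h.contDiffAt_potential (chart_mem_chartDomain hy hy')).of_le ENat.LEInfty.out
  have h2 := ddc_comp h1 (hGc.of_le le_top) (show E from v)
  rw [ddc_congr hpot, ddc_add ((h.contDiffAt_potential hzd).of_le ENat.LEInfty.out)
    (contDiffAt_log_norm (hτc.of_le le_top) hτ0), ddc_log_norm hτc hτ0, add_zero, hGz] at h2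
  exact h2

/-- Near `x₀`, the norm of the Chern form dominates the norm of `E` in the chart at `x₀`. -/
lemma exists_norm_chartDeriv_le [FiniteDimensional ℂ E] [IsManifold 𝓘(ℂ, E) ω X]
    [ContMDiffVectorBundle ω ℂ L 𝓘(ℂ, E)] (h_pos : h.IsPositive) (x₀ : X) :
    ∃ C > 0, ∃ R > 0, Metric.closedBall (chartAt E x₀ x₀) R ⊆ (chartAt E x₀).target ∧
      ∀ y ∈ (chartAt E x₀).source, chartAt E x₀ y ∈ Metric.closedBall (chartAt E x₀ x₀) R →
        ∀ v : E, ‖chartDeriv x₀ y v‖ ≤ C * √(h.chernForm y v) := by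
  set z₀ := chartAt E x₀ x₀ with hz₀
  have hz₀d : z₀ ∈ chartDomain L E x₀ := chart_self_mem_chartDomain x₀
  have hu : ContDiffAt ℝ 2 (h.potential x₀) z₀ :=
    (h.contDiffAt_potential hz₀d).of_le ENat.LEInfty.out
  obtain ⟨c, hc, hev⟩ := exists_ddc_lower_bound hu fun v hv => h_pos x₀ v hv
  obtain ⟨R, hR, hsub⟩ := Metric.nhds_basis_closedBall.mem_iff.1
    (hev.and ((isOpen_chartDomain (L := L) x₀).mem_nhds hz₀d))
  refine ⟨(√c)⁻¹, by positivity, R, hR, fun z hz => (hsub hz).2.1, fun y hy hyR v => ?_⟩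
  have hyd : chartAt E x₀ y ∈ chartDomain L E x₀ := (hsub hyR).2
  have hy' : y ∈ (trivializationAt ℂ L x₀).baseSet := by
    simpa [(chartAt E x₀).left_inv hy] using hyd.2
  have h1 := ((hsub hyR).1 (chartDeriv x₀ y v)).trans_eq (h.chernForm_eq_ddc hy hy' v).symm
  rw [← div_eq_inv_mul, le_div_iff₀ (by positivity), mul_comm]
  refine Real.le_sqrt_of_sq_le ?_
  rwa [mul_pow, Real.sq_sqrt hc.le]

/-! ### The Riemannian distance in charts -/

/-- Small balls for the Riemannian distance of `ω₀` are contained in comparable balls in charts. -/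
lemma exists_ball_subset_chart_ball [FiniteDimensional ℂ E] [T2Space X]
    [IsManifold 𝓘(ℂ, E) ω X] [ContMDiffVectorBundle ω ℂ L 𝓘(ℂ, E)] (h_pos : h.IsPositive)
    (x₀ : X) :
    ∃ C > 0, ∃ R > 0, ∀ x ∈ (chartAt E x₀).source,
      chartAt E x₀ x ∈ Metric.ball (chartAt E x₀ x₀) R → ∀ r, 0 < r → C * r ≤ R →
        ∀ y ∈ h.ball x r, y ∈ (chartAt E x₀).source ∧
          ‖chartAt E x₀ y - chartAt E x₀ x‖ ≤ C * r := by
  obtain ⟨C, hC, R, hR, hsub, hbound⟩ := h.exists_norm_chartDeriv_le h_pos x₀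
  -- Halving `R` ensures that the closed ball of radius `C * r ≤ R / 2` about the image of `x` stays
  -- where the bound on `chartDeriv` holds.
  refine ⟨C, hC, R / 2, half_pos hR, fun x hx hxR r hr hCr y hy => ?_⟩
  have : IsManifold 𝓘(ℝ, E) ∞ X := isManifold_real
  have : IsManifold 𝓘(ℝ, E) 1 X := IsManifold.of_le (n := ∞) (by norm_num)
  have : ProperSpace E := FiniteDimensional.proper ℂ E
  set e := chartAt E x₀ with he
  let : ∀ x : X, ENorm (TangentSpace 𝓘(ℝ, E) x) :=
    fun x => ⟨fun v => ENNReal.ofReal √(h.chernForm x v)⟩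
  have hy' : Manifold.riemannianEDist 𝓘(ℝ, E) x y < ENNReal.ofReal r := hy
  obtain ⟨γ, hγ0, hγ1, hγ, hlen⟩ := Manifold.exists_lt_of_riemannianEDist_lt hy'
  set D : Set X := e.symm '' Metric.closedBall (e x) (C * r) with hD
  have hball : Metric.closedBall (e x) (C * r) ⊆ Metric.ball (e x₀) R := by
    intro z hz
    rw [Metric.mem_ball] at hxR ⊢
    rw [Metric.mem_closedBall] at hz
    linarith [dist_triangle z (e x) (e x₀)]
  have hballt : Metric.closedBall (e x) (C * r) ⊆ e.target :=
    hball.trans (Metric.ball_subset_closedBall.trans hsub)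
  have hDclosed : IsClosed D :=
    ((isCompact_closedBall (e x) (C * r)).image_of_continuousOn
      (e.continuousOn_symm.mono hballt)).isClosed
  set V : Set X := e.source ∩ e ⁻¹' Metric.ball (e x₀) R with hV
  have hVopen : IsOpen V := e.isOpen_inter_preimage Metric.isOpen_ball
  have hDV : D ⊆ V := by
    rintro _ ⟨z, hz, rfl⟩
    refine ⟨e.map_target (hballt hz), ?_⟩
    rw [mem_preimage, e.right_inv (hballt hz)]
    exact hball hz
  have hmemD : ∀ q ∈ V, ‖e q - e x‖ ≤ C * r → q ∈ D := fun q hq hle =>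
    ⟨e q, by rwa [Metric.mem_closedBall, dist_eq_norm], e.left_inv hq.1⟩
  -- While the path stays in `V`, its image in the chart moves by at most `C` times its length.
  have hstep : ∀ t ∈ Icc (0 : ℝ) 1, (∀ s ∈ Icc 0 t, γ s ∈ V) → ‖e (γ t) - e x‖ ≤ C * r := by
    intro t ht hs
    rcases ht.1.eq_or_lt with rfl | htpos
    · rw [hγ0, sub_self, norm_zero]; positivity
    have hsubI : Icc 0 t ⊆ Icc (0 : ℝ) 1 := Icc_subset_Icc_right ht.2
    set γ' := extChartAt 𝓘(ℝ, E) x₀ ∘ γ with hγ'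
    have hγ's : ∀ s, γ' s = e (γ s) := fun s => by simp [γ', e]
    have hCM : ContMDiffOn 𝓘(ℝ, ℝ) 𝓘(ℝ, E) 1 γ' (Icc 0 t) :=
      contMDiffOn_extChartAt.comp (I' := 𝓘(ℝ, E)) (t := (chartAt E x₀).source)
        (hγ.mono hsubI) (fun s hs' => (hs s hs').1)
    have hle : ‖γ' t - γ' 0‖ₑ ≤ ENNReal.ofReal C * ENNReal.ofReal r := by
      calc ‖γ' t - γ' 0‖ₑ
      _ ≤ ∫⁻ s in Icc 0 t, ‖derivWithin γ' (Icc 0 t) s‖ₑ := by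
        apply enorm_sub_le_lintegral_derivWithin_Icc_of_contDiffOn_Icc _ ht.1
        rwa [← contMDiffOn_iff_contDiffOn]
      _ ≤ ∫⁻ s in Icc 0 t, ENNReal.ofReal C *
          ‖mfderivWithin 𝓘(ℝ, ℝ) 𝓘(ℝ, E) γ (Icc 0 t) s 1‖ₑ := by
        apply setLIntegral_mono' measurableSet_Icc (fun s hs' ↦ ?_)
        have hcomp : mfderivWithin 𝓘(ℝ, ℝ) 𝓘(ℝ, E) γ' (Icc 0 t) s =
            (mfderiv 𝓘(ℝ, E) 𝓘(ℝ, E) (extChartAt 𝓘(ℝ, E) x₀) (γ s)) ∘L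
              (mfderivWithin 𝓘(ℝ, ℝ) 𝓘(ℝ, E) γ (Icc 0 t) s) := by
          apply mfderiv_comp_mfderivWithin
          · exact mdifferentiableAt_extChartAt (hs s hs').1
          · exact ((hγ.mono hsubI).mdifferentiableOn one_ne_zero) _ hs'
          · rw [uniqueMDiffWithinAt_iff_uniqueDiffWithinAt]
            exact uniqueDiffOn_Icc htpos _ hs'
        have hval : derivWithin γ' (Icc 0 t) s =
            chartDeriv x₀ (γ s) (show E from mfderivWithin 𝓘(ℝ, ℝ) 𝓘(ℝ, E) γ (Icc 0 t) s 1) := by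
          rw [← mfderiv_extChartAt_apply (hs s hs').1, ← fderivWithin_derivWithin,
            ← mfderivWithin_eq_fderivWithin]
          exact congrArg (fun l => l 1) hcomp
        rw [hval]
        have hb := hbound (γ s) (hs s hs').1 (Metric.ball_subset_closedBall (hs s hs').2)
          (mfderivWithin 𝓘(ℝ, ℝ) 𝓘(ℝ, E) γ (Icc 0 t) s 1)
        rw [← ofReal_norm]
        refine (ENNReal.ofReal_le_ofReal hb).trans_eq ?_
        rw [ENNReal.ofReal_mul hC.le]
        rfl
      _ = ENNReal.ofReal C * Manifold.pathELength 𝓘(ℝ, E) γ 0 t := by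
        rw [lintegral_const_mul' _ _ ENNReal.ofReal_ne_top,
          Manifold.pathELength_eq_lintegral_mfderivWithin_Icc]
      _ ≤ ENNReal.ofReal C * Manifold.pathELength 𝓘(ℝ, E) γ 0 1 := by
        exact mul_le_mul_right (Manifold.pathELength_mono le_rfl ht.2) _
      _ ≤ ENNReal.ofReal C * ENNReal.ofReal r := by
        gcongr
    rw [← ENNReal.ofReal_mul hC.le, hγ's, hγ's, hγ0, ← ofReal_norm,
      ENNReal.ofReal_le_ofReal_iff (by positivity)] at hle
    exact hle
  have hxV : x ∈ V := ⟨hx, Metric.ball_subset_ball (by linarith) hxR⟩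
  have hxD : x ∈ D := hmemD x hxV (by rw [sub_self, norm_zero]; positivity)
  have hγc : ContinuousOn γ (Icc 0 1) := hγ.continuousOn
  -- Continuity argument: a path in the closed set `D` remains for a short time in the open set `V ⊇
  -- D`, and `hstep` puts it back in `D`; so it never leaves the chart.
  have hsubD : Icc (0 : ℝ) 1 ⊆ γ ⁻¹' D := by
    have hcl : IsClosed (γ ⁻¹' D ∩ Icc 0 1) := by
      rw [inter_comm]
      exact hγc.preimage_isClosed_of_isClosed isClosed_Icc hDclosed
    refine hcl.Icc_subset_of_forall_mem_nhdsGT_of_Icc_subset (by simpa [hγ0] using hxD) ?_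
    intro t ht hsubt
    have hγt : ContinuousWithinAt γ (Icc t 1) t :=
      (hγc t (Ico_subset_Icc_self ht)).mono (Icc_subset_Icc_left ht.1)
    have hev : ∀ᶠ s in 𝓝[≥] t, γ s ∈ V := by
      rw [← nhdsWithin_Icc_eq_nhdsGE ht.2]
      exact hγt.eventually (hVopen.mem_nhds (hDV (hsubt (right_mem_Icc.2 ht.1))))
    obtain ⟨u, htu, hu⟩ := mem_nhdsGE_iff_exists_Ico_subset.1 hev
    filter_upwards [Ioo_mem_nhdsGT htu, Ioo_mem_nhdsGT ht.2] with s hs1 hs2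
    have hsV : ∀ s' ∈ Icc 0 s, γ s' ∈ V := by
      intro s' hs'
      rcases le_total s' t with hle | hle
      · exact hDV (hsubt ⟨hs'.1, hle⟩)
      · exact hu ⟨hle, hs'.2.trans_lt hs1.2⟩
    have hs0 : 0 ≤ s := ht.1.trans hs1.1.le
    exact hmemD _ (hsV s ⟨hs0, le_rfl⟩) (hstep s ⟨hs0, hs2.2.le⟩ hsV)
  have h1 := hsubD (right_mem_Icc.2 zero_le_one)
  rw [mem_preimage, hγ1] at h1
  have h2 := hDV h1
  obtain ⟨z, hz, rfl⟩ := h1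
  refine ⟨h2.1, ?_⟩
  rw [e.right_inv (hballt hz), ← dist_eq_norm]
  exact hz

end HermitianMetric

/-- A lower bound, near a point where it is almost extremal, for the weighted modulus of a
holomorphic function that is dominated by a Hölder continuous weight. -/
lemma quarter_le_norm_mul_exp {E : Type*} [NormedAddCommGroup E] [NormedSpace ℂ E] {F : E → ℂ}
    {u v : E → ℝ} {x y : E} {r M P C β : ℝ} (hF : DifferentiableOn ℂ F (Metric.ball x r))
    (hr : 0 < r) (hM : 0 < M) (hP : 0 ≤ P) (hC : 0 ≤ C) (hβ : 0 < β)
    (hPr : P * r ^ β ≤ 1)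
    (hFu : ∀ w ∈ Metric.ball x r, ‖F w‖ ≤ M * Real.exp (P * u w))
    (hu : ∀ w ∈ Metric.ball x r, |u w - u x| ≤ C * ‖w - x‖ ^ β)
    (hv : ∀ w ∈ Metric.ball x r, |v w - v x| ≤ C * ‖w - x‖ ^ β)
    (huv : u x ≤ v x) (hx : M / 2 ≤ ‖F x‖ * Real.exp (-(P * v x)))
    (hy : ‖y - x‖ ≤ Real.exp (-C) / 8 * r) :
    M * Real.exp (-C) / 4 ≤ ‖F y‖ * Real.exp (-(P * v y)) := by
  have hosc : ∀ w ∈ Metric.ball x r, P * (C * ‖w - x‖ ^ β) ≤ C := by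
    intro w hw
    rw [Metric.mem_ball, dist_eq_norm] at hw
    have h1 : ‖w - x‖ ^ β ≤ r ^ β := Real.rpow_le_rpow (norm_nonneg _) hw.le hβ.le
    calc P * (C * ‖w - x‖ ^ β) = C * (P * ‖w - x‖ ^ β) := by ring
      _ ≤ C * (P * r ^ β) := by gcongr
      _ ≤ C * 1 := by gcongr
      _ = C := mul_one C
  -- Since `u x ≤ v x`, the growth bound with weight `u` becomes one in terms of `v x`, comparable
  -- to the lower bound at `x`.
  have hB : ∀ w ∈ Metric.ball x r, ‖F w‖ ≤ M * Real.exp (P * v x + C) := by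
    intro w hw
    refine (hFu w hw).trans ?_
    gcongr
    have h1 := (abs_le.1 (hu w hw)).2
    have h2 : P * (u w - u x) ≤ P * (C * ‖w - x‖ ^ β) := by gcongr
    have h3 : P * u x ≤ P * v x := by gcongr
    linarith [hosc w hw]
  have hm : M / 2 * Real.exp (P * v x) ≤ ‖F x‖ := by
    have := mul_le_mul_of_nonneg_right hx (Real.exp_pos (P * v x)).le
    rwa [mul_assoc, ← Real.exp_add, neg_add_cancel, Real.exp_zero, mul_one] at this
  have hexp : Real.exp (-C) ≤ 1 := Real.exp_le_one_iff.2 (by linarith)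
  -- The shrinking factor `m / (4B)` depends neither on `M` nor on `P`, hence not on the section or
  -- on `p`.
  have hκ : M / 2 * Real.exp (P * v x) / (4 * (M * Real.exp (P * v x + C))) =
      Real.exp (-C) / 8 := by
    rw [Real.exp_add, Real.exp_neg]
    have := (Real.exp_pos (P * v x)).ne'
    have := (Real.exp_pos C).ne'
    field_simp
    ring
  have hhalf := half_le_norm_of_norm_le hF (by positivity) hm hB hr (by rwa [hκ])
  have hyr : y ∈ Metric.ball x r := by
    rw [Metric.mem_ball, dist_eq_norm]
    refine hy.trans_lt ?_
    nlinarith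
  have hvy : P * v y ≤ P * v x + C := by
    have h1 := (abs_le.1 (hv y hyr)).2
    have h2 : P * (v y - v x) ≤ P * (C * ‖y - x‖ ^ β) := by gcongr
    linarith [hosc y hyr]
  calc M * Real.exp (-C) / 4
      = M / 2 * Real.exp (P * v x) / 2 * Real.exp (-(P * v x + C)) := by
        rw [neg_add, Real.exp_add, Real.exp_neg (P * v x)]
        have := (Real.exp_pos (P * v x)).ne'
        field_simp
        ring
    _ ≤ ‖F y‖ * Real.exp (-(P * v y)) := by gcongr

/-- A power of `p` is dominated by the exponential of any positive power of `p`. -/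
lemma rpow_le_exp_mul_rpow {p N η : ℝ} (hp : 1 ≤ p) (hN : 0 ≤ N) (hη : 0 < η) :
    p ^ N ≤ Real.exp (N / η * p ^ η) := by
  have hp0 : 0 < p := by linarith
  rw [Real.rpow_def_of_pos hp0, Real.exp_le_exp]
  have := Real.log_le_rpow_div hp0.le hη
  calc Real.log p * N ≤ p ^ η / η * N := by gcongr
    _ = N / η * p ^ η := by ring

/-! ### Sections of powers of the line bundle -/

section Sections

variable {E : Type*} [NormedAddCommGroup E] [NormedSpace ℂ E]
  {X : Type*} [TopologicalSpace X] [ChartedSpace E X]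
  {L : X → Type*} [∀ x, AddCommGroup (L x)] [∀ x, Module ℂ (L x)] [∀ x, TopologicalSpace (L x)]
  [TopologicalSpace (TotalSpace ℂ L)] [FiberBundle ℂ L] [VectorBundle ℂ ℂ L]

/-- It suffices to test pure tensors, where each of the `p` factors contributes one transition
function. -/
lemma coord_eq_transition_pow_mul {x₀ q : X} (hq : q ∈ (trivializationAt ℂ L x₀).baseSet) (y : X)
    (p : ℕ) (t : ⨂[ℂ]^p (L q)) :
    coord L p y q t = transition L y x₀ q ^ p * coord L p x₀ q t := by
  have : coord L p y q = (transition L y x₀ q ^ p) • coord L p x₀ q := by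
    refine PiTensorProduct.ext (MultilinearMap.ext fun v => ?_)
    simp only [coord, LinearMap.compMultilinearMap_apply, PiTensorProduct.lift.tprod,
      LinearMap.smul_apply, MultilinearMap.compLinearMap_apply, MultilinearMap.mkPiAlgebra_apply,
      smul_eq_mul]
    have hv : ∀ i, (trivializationAt ℂ L y).linearMapAt ℂ q (v i) =
        transition L y x₀ q * (trivializationAt ℂ L x₀).linearMapAt ℂ q (v i) := by
      intro i
      conv_lhs => rw [eq_linearMapAt_smul_frame hq (v i), map_smul, smul_eq_mul, mul_comm]
      rfl
    simp only [hv, Finset.prod_mul_distrib, Finset.prod_const, Finset.card_univ, Fintype.card_fin]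
  rw [this, LinearMap.smul_apply, smul_eq_mul]

namespace HermitianMetric

variable (h : HermitianMetric L E)

/-- The norm on `L^p` computed in the frame at another point. -/
lemma normPow_eq {x₀ q : X} (hq : q ∈ (trivializationAt ℂ L x₀).baseSet) (p : ℕ)
    (t : ⨂[ℂ]^p (L q)) :
    h.normPow p q t = ‖coord L p x₀ q t‖ * h.norm q (frame L x₀ q) ^ p := by
  have hqq : q ∈ (trivializationAt ℂ L q).baseSet := FiberBundle.mem_baseSet_trivializationAt' q
  rw [normPow, coord_eq_transition_pow_mul hq q, frame_eq_smul hqq x₀, norm_smul, norm_mul,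
    norm_pow, mul_pow]
  ring

lemma normPow_nonneg (p : ℕ) (x : X) (t : ⨂[ℂ]^p (L x)) : 0 ≤ h.normPow p x t := by
  rw [normPow, HermitianMetric.norm]
  positivity

lemma normPow_chart {x₀ : X} {p : ℕ} (s : ∀ x, ⨂[ℂ]^p (L x)) {z : E}
    (hz : z ∈ chartDomain L E x₀) :
    h.normPow p ((chartAt E x₀).symm z) (s ((chartAt E x₀).symm z)) =
      ‖((fun x => coord L p x₀ x (s x)) ∘ (chartAt E x₀).symm) z‖ *
        Real.exp (-(p * h.potential x₀ z)) := by
  rw [h.normPow_eq hz.2, h.norm_frame_eq_exp_potential hz, ← Real.exp_nat_mul, mul_neg]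
  rfl

lemma continuous_normPow {p : ℕ} {s : ∀ x, ⨂[ℂ]^p (L x)} (hs : IsHolomorphicSection L E s) :
    Continuous fun x => h.normPow p x (s x) := by
  refine continuous_iff_continuousAt.2 fun x₀ => ?_
  have hmem : (trivializationAt ℂ L x₀).baseSet ∈ 𝓝 x₀ :=
    (trivializationAt ℂ L x₀).open_baseSet.mem_nhds (FiberBundle.mem_baseSet_trivializationAt' x₀)
  have h1 : ContinuousAt (fun x => coord L p x₀ x (s x)) x₀ :=
    (hs x₀).continuousOn.continuousAt hmem
  have h2 : ContinuousAt (fun x => h.norm x (frame L x₀ x)) x₀ :=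
    ((h.smooth x₀).continuousOn.continuousAt hmem).sqrt
  refine (h1.norm.mul (h2.pow p)).congr ?_
  filter_upwards [hmem] with x hx
  exact (h.normPow_eq hx p (s x)).symm

/-- The function `(1 / p) log (|s| / M)` attached to a section `s` of `L^p`. -/
def logSection {p : ℕ} (s : ∀ x, ⨂[ℂ]^p (L x)) (M : ℝ) (x : X) : EReal :=
  elog ((h.normPow p x (s x) / M) ^ (p : ℝ)⁻¹)

/-- Adding the potential cancels the norm of the frame and leaves `(1/p) log (|F|/M)`, with `F` the
holomorphic coordinate of `s`. The hypothesis `hne` excludes the constant `-∞`. -/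
lemma isOmegaPsh_logSection [IsManifold 𝓘(ℂ, E) ω X] {p : ℕ} (hp : 1 ≤ p)
    {s : ∀ x, ⨂[ℂ]^p (L x)} (hs : IsHolomorphicSection L E s) {M : ℝ} (hM : 0 < M)
    (hne : ∃ x, 0 < h.normPow p x (s x)) : h.IsOmegaPsh (h.logSection s M) := by
  have hp0 : (0 : ℝ) < p := by exact_mod_cast hp
  refine ⟨?_, fun x₀ => ?_⟩
  · obtain ⟨x, hx⟩ := hne
    refine ⟨x, fun hbot => ?_⟩
    rw [logSection, elog, ENNReal.log_eq_bot_iff, ENNReal.ofReal_eq_zero] at hbot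
    exact absurd hbot (not_le.2 (by positivity))
  · have hF := differentiableOn_comp_chart_symm (hs x₀) x₀
    refine (isPshOn_elog_rpow_norm (isOpen_chartDomain x₀) hF
      (b := M⁻¹ ^ (p : ℝ)⁻¹) (c := (p : ℝ)⁻¹) (by positivity) (by positivity)).congr ?_
    intro z hz
    have hnn := h.normPow_nonneg p _ (s ((chartAt E x₀).symm z))
    simp only [logSection]
    rw [elog_add_coe (by positivity), h.normPow_chart s hz, div_eq_mul_inv,
      Real.mul_rpow (by positivity) (by positivity), Real.mul_rpow (by positivity) (by positivity),
      ← Real.exp_mul]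
    congr 1
    have : Real.exp (-(p * h.potential x₀ z) * (p : ℝ)⁻¹) * Real.exp (h.potential x₀ z) = 1 := by
      rw [← Real.exp_add, Real.exp_eq_one_iff]
      field_simp
      ring
    rw [mul_comm (_ * Real.exp _), mul_assoc, mul_assoc, this, mul_one]

lemma logSection_le_coe {p : ℕ} (hp : 1 ≤ p) {s : ∀ x, ⨂[ℂ]^p (L x)} {M : ℝ} (hM : 0 < M)
    {x : X} {b : ℝ} : h.logSection s M x ≤ b ↔ h.normPow p x (s x) ≤ M * Real.exp (p * b) := by
  have hp0 : (0 : ℝ) < p := by exact_mod_cast hp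
  have hnn := h.normPow_nonneg p _ (s x)
  rw [logSection, elog_le_coe, Real.rpow_inv_le_iff_of_pos (by positivity) (Real.exp_pos b).le hp0,
    ← Real.exp_mul, div_le_iff₀ hM, mul_comm b, mul_comm M]

variable {K W : Set X} {φ : X → ℝ}

lemma extremal_le_equilibrium (z : X) : h.extremal K φ z ≤ h.equilibrium K φ z := by
  refine le_limsup_of_frequently_le' ?_
  exact Filter.Frequently.filter_mono (f := pure z) (by simp) (pure_le_nhds z)

/-- Upper semicontinuity means that regularizing does not raise the envelope, so the bound by `φ`
persists at every point of `K`. -/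
lemma equilibrium_le (husc : UpperSemicontinuous (h.extremal K φ)) {x : X} (hx : x ∈ K) :
    h.equilibrium K φ x ≤ φ x :=
  (upperSemicontinuous_iff_limsup_le.1 husc x).trans (iSup₂_le fun _ hψ => hψ.2 x hx)

/-- A section of `L^p` is dominated by the equilibrium weight. -/
lemma normPow_le_exp_equilibrium [IsManifold 𝓘(ℂ, E) ω X] {p : ℕ} (hp : 1 ≤ p)
    {s : ∀ x, ⨂[ℂ]^p (L x)} (hs : IsHolomorphicSection L E s) {M : ℝ} (hM : 0 < M)
    (hsK : ∀ x ∈ K, h.normPow p x (s x) * Real.exp (-(p * φ x)) ≤ M)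
    {g : X → ℝ} (hg : ∀ z, h.equilibrium K φ z = g z) (z : X) :
    h.normPow p z (s z) ≤ M * Real.exp (p * g z) := by
  by_cases hne : ∃ x, 0 < h.normPow p x (s x)
  · have hψ := h.isOmegaPsh_logSection hp hs hM hne
    have hψK : ∀ x ∈ K, h.logSection s M x ≤ φ x := by
      intro x hx
      rw [h.logSection_le_coe hp hM]
      have := hsK x hx
      rwa [Real.exp_neg, ← div_eq_mul_inv, div_le_iff₀ (Real.exp_pos _)] at this
    rw [← h.logSection_le_coe hp hM, ← hg]
    refine le_trans ?_ (h.extremal_le_equilibrium z)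
    exact le_iSup₂_of_le (h.logSection s M) ⟨hψ, hψK⟩ le_rfl
  · push Not at hne
    exact (hne z).trans (by positivity)

/-- The maximum principle for sections: the supremum on `K` is almost reached on `W`. -/
lemma MaximumPrinciple.exists_half_le [IsManifold 𝓘(ℂ, E) ω X] (h_max : h.MaximumPrinciple W K φ)
    {p : ℕ} (hp : 1 ≤ p) {s : ∀ x, ⨂[ℂ]^p (L x)} (hs : IsHolomorphicSection L E s)
    {M : ℝ} (hM : 0 < M) {x₁ : X} (hx₁ : x₁ ∈ K)
    (hMx₁ : h.normPow p x₁ (s x₁) * Real.exp (-(p * φ x₁)) = M) :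
    ∃ x ∈ W, M / 2 ≤ h.normPow p x (s x) * Real.exp (-(p * φ x)) := by
  have hp0 : (0 : ℝ) < p := by exact_mod_cast hp
  have hpos : 0 < h.normPow p x₁ (s x₁) := by
    refine (h.normPow_nonneg p x₁ (s x₁)).lt_of_ne fun h0 => ?_
    rw [← h0, zero_mul] at hMx₁
    exact hM.ne hMx₁
  have hval : ∀ x, h.logSection s M x - (φ x : EReal) =
      elog ((h.normPow p x (s x) * Real.exp (-(p * φ x)) / M) ^ (p : ℝ)⁻¹) := by
    intro x
    have hnn := h.normPow_nonneg p x (s x)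
    rw [logSection, elog_sub_coe (by positivity), mul_div_right_comm,
      Real.mul_rpow (by positivity) (by positivity), ← Real.exp_mul]
    congr 3
    field_simp
  have hmax := h_max.2.2 _ (h.isOmegaPsh_logSection hp hs hM ⟨x₁, hpos⟩)
  simp only [hval] at hmax
  -- The factor `1/2` spares any discussion of whether the supremum on `W` is attained: otherwise
  -- that supremum is at most `(1/p) log (1/2) < 0`, while the value at `x₁` is `0`.
  by_contra! hW
  have h1 : elog 1 ≤ elog ((1 / 2) ^ (p : ℝ)⁻¹) := by
    calc elog 1 = elog ((h.normPow p x₁ (s x₁) * Real.exp (-(p * φ x₁)) / M) ^ (p : ℝ)⁻¹) := by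
          rw [hMx₁, div_self hM.ne', Real.one_rpow]
      _ ≤ _ := le_iSup₂ (f := fun x (_ : x ∈ K) =>
        elog ((h.normPow p x (s x) * Real.exp (-(p * φ x)) / M) ^ (p : ℝ)⁻¹)) x₁ hx₁
      _ = _ := hmax
      _ ≤ _ := by
        refine iSup₂_le fun x hx => ENNReal.log_le_log (ENNReal.ofReal_le_ofReal ?_)
        have hnn := h.normPow_nonneg p x (s x)
        refine Real.rpow_le_rpow (by positivity) ?_ (by positivity)
        rw [div_le_iff₀ hM]
        linarith [hW x hx]
  have h2 : (1 : ℝ) ≤ (1 / 2) ^ (p : ℝ)⁻¹ := by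
    rw [elog, elog, ENNReal.log_le_log_iff, ENNReal.ofReal_le_ofReal_iff (by positivity)] at h1
    exact h1
  exact absurd h2 (not_le.2 (Real.rpow_lt_one (by norm_num) (by norm_num) (by positivity)))

end HermitianMetric

end Sections

/-! ### Lower bounds on small balls and the resulting `L²` estimate -/

namespace HermitianMetric

section Main

variable {E : Type*} [NormedAddCommGroup E] [NormedSpace ℂ E]
  {X : Type*} [TopologicalSpace X] [ChartedSpace E X]
  {L : X → Type*} [∀ x, AddCommGroup (L x)] [∀ x, Module ℂ (L x)] [∀ x, TopologicalSpace (L x)]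
  [TopologicalSpace (TotalSpace ℂ L)] [FiberBundle ℂ L] [VectorBundle ℂ ℂ L]
  (h : HermitianMetric L E) {K W : Set X} {φ f g : X → ℝ}

/-- Potentials are Hölder continuous near the centre of the chart. -/
lemma exists_holder_potential [IsManifold 𝓘(ℂ, E) ω X] {β : ℝ} (hβ : 0 < β) (hβ1 : β ≤ 1)
    (x₀ : X) :
    ∃ r > 0, ∃ C : ℝ, 0 ≤ C ∧ Metric.ball (chartAt E x₀ x₀) r ⊆ chartDomain L E x₀ ∧
      ∀ z ∈ Metric.ball (chartAt E x₀ x₀) r, ∀ w ∈ Metric.ball (chartAt E x₀ x₀) r,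
        |h.potential x₀ z - h.potential x₀ w| ≤ C * ‖z - w‖ ^ β := by
  have hd : chartAt E x₀ x₀ ∈ chartDomain L E x₀ := chart_self_mem_chartDomain x₀
  obtain ⟨C, t, ht, hC⟩ := ((h.contDiffAt_potential hd).of_le
    (ENat.LEInfty.out : 1 ≤ (∞ : ℕ∞ω))).exists_lipschitzOnWith
  obtain ⟨r, hr, hsub⟩ := Metric.mem_nhds_iff.1 (inter_mem ht ((isOpen_chartDomain x₀).mem_nhds hd))
  refine ⟨min r (1 / 2), by positivity, C, C.2, fun z hz =>
    (hsub (Metric.ball_subset_ball (min_le_left _ _) hz)).2, fun z hz w hw => ?_⟩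
  have h1 := hC.dist_le_mul z (hsub (Metric.ball_subset_ball (min_le_left _ _) hz)).1
    w (hsub (Metric.ball_subset_ball (min_le_left _ _) hw)).1
  rw [Real.dist_eq, dist_eq_norm] at h1
  refine h1.trans (mul_le_mul_of_nonneg_left ?_ C.2)
  have h2 : dist z (chartAt E x₀ x₀) < 1 / 2 := (Metric.mem_ball.1 hz).trans_le (min_le_right _ _)
  have h3 : dist w (chartAt E x₀ x₀) < 1 / 2 := (Metric.mem_ball.1 hw).trans_le (min_le_right _ _)
  have hzw : ‖z - w‖ ≤ 1 := by
    rw [← dist_eq_norm]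
    linarith [dist_triangle_right z w (chartAt E x₀ x₀)]
  simpa using rpow_le_rpow_of_le_one_of_le (norm_nonneg (z - w)) hzw hβ hβ1

/-- If the weighted norm of a section of `L^p` is almost maximal at `x`, then it is almost maximal
on a Riemannian ball of centre `x` and radius comparable to `p ^ (-1 / β)`. -/
lemma exists_ball_quarter_le [FiniteDimensional ℂ E] [T2Space X] [IsManifold 𝓘(ℂ, E) ω X]
    [ContMDiffVectorBundle ω ℂ L 𝓘(ℂ, E)] (h_pos : h.IsPositive) {β : ℝ} (hβ : 0 < β)
    (hβ1 : β ≤ 1) {α α' : ℝ} (hβα : β ≤ α) (hβα' : β ≤ α') {S T : Set (X → ℝ)}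
    (hS : IsBoundedHolder (E := E) α S) (hT : IsBoundedHolder (E := E) α' T) (hf : f ∈ S)
    (hg : g ∈ T) (hgf : ∀ x ∈ K, g x ≤ f x) (x₀ : X) :
    ∃ U ∈ 𝓝 x₀, ∃ a > 0, a < 1 ∧ ∃ b > 0, ∀ p : ℕ, 1 ≤ p → ∀ s : ∀ x, ⨂[ℂ]^p (L x),
      IsHolomorphicSection L E s → ∀ M > 0,
      (∀ z, h.normPow p z (s z) ≤ M * Real.exp (p * g z)) →
      ∀ x ∈ U, x ∈ K → M / 2 ≤ h.normPow p x (s x) * Real.exp (-(p * f x)) →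
      ∀ y ∈ h.ball x (a * (p : ℝ) ^ (-β⁻¹)),
        b * M ≤ h.normPow p y (s y) * Real.exp (-(p * f y)) := by
  obtain ⟨rf, hrf, Cf, hCf, -, hfH⟩ := hS.exists_holder hβ hβα hβ1 x₀
  obtain ⟨rg, hrg, Cg, hCg, -, hgH⟩ := hT.exists_holder hβ hβα' hβ1 x₀
  obtain ⟨ru, hru, Cu, hCu, hud, huH⟩ := h.exists_holder_potential hβ hβ1 x₀
  obtain ⟨D, hD, rd, hrd, hball⟩ := h.exists_ball_subset_chart_ball h_pos x₀
  set e := chartAt E x₀ with he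
  set R : ℝ := min (min rf rg) (min (min ru rd) 1) with hR
  have hR0 : 0 < R := by positivity
  have hRf : R ≤ rf := (min_le_left _ _).trans (min_le_left _ _)
  have hRg : R ≤ rg := (min_le_left _ _).trans (min_le_right _ _)
  have hRu : R ≤ ru := (min_le_right _ _).trans ((min_le_left _ _).trans (min_le_left _ _))
  have hRd : R ≤ rd := (min_le_right _ _).trans ((min_le_left _ _).trans (min_le_right _ _))
  have hR1 : R ≤ 1 := (min_le_right _ _).trans (min_le_right _ _)
  set C : ℝ := Cf + Cg + Cu with hC
  have hC0 : 0 ≤ C := by positivity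
  set κ : ℝ := Real.exp (-C) / 8 with hκ
  have hκ0 : 0 < κ := by positivity
  have hκ1 : κ ≤ 1 := by
    have : Real.exp (-C) ≤ 1 := Real.exp_le_one_iff.2 (by linarith)
    rw [hκ]; linarith
  -- The radius factor has `κ * (R / 2) / D` so that `D` times the Riemannian radius is at most `κ *
  -- r`, the reach of `quarter_le_norm_mul_exp`; the bound `1/2` makes mass density applicable.
  refine ⟨e.source ∩ e ⁻¹' Metric.ball (e x₀) (R / 2),
    (e.isOpen_inter_preimage Metric.isOpen_ball).mem_nhds
      ⟨mem_chart_source E x₀, Metric.mem_ball_self (by positivity)⟩,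
    min (1 / 2) (κ * (R / 2) / D), by positivity, (min_le_left _ _).trans_lt (by norm_num),
    Real.exp (-C) / 4, by positivity, ?_⟩
  rintro p hp s hs M hM hsg x ⟨hxs, hxR⟩ hxK hxM y hy
  have hp1 : (1 : ℝ) ≤ p := by exact_mod_cast hp
  have hp0 : (0 : ℝ) < p := by linarith
  set P : ℝ := (p : ℝ) ^ (-β⁻¹) with hP
  have hP0 : 0 < P := by positivity
  have hP1 : P ≤ 1 := Real.rpow_le_one_of_one_le_of_nonpos hp1 (by simp [hβ.le])
  -- With `P = p^{-1/β}` and `R / 2 ≤ 1`, this gives `p * r ^ β ≤ 1`.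
  set r : ℝ := R / 2 * P with hr
  have hr0 : 0 < r := by positivity
  have hrR : r ≤ R / 2 := mul_le_of_le_one_right (by positivity) hP1
  have hDr : D * (min (1 / 2) (κ * (R / 2) / D) * P) ≤ κ * r := by
    calc D * (min (1 / 2) (κ * (R / 2) / D) * P) ≤ D * ((κ * (R / 2) / D) * P) := by
          gcongr
          exact min_le_right _ _
      _ = κ * r := by rw [hr]; field_simp
  have hκr : κ * r ≤ r := mul_le_of_le_one_left hr0.le hκ1
  have hxR' : e x ∈ Metric.ball (e x₀) rd := Metric.ball_subset_ball (by linarith) hxR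
  obtain ⟨hys, hyx⟩ := hball x hxs hxR' _ (by positivity) (by linarith) y hy
  have hsubR : Metric.ball (e x) r ⊆ Metric.ball (e x₀) R := by
    refine Metric.ball_subset_ball' ?_
    have := Metric.mem_ball.1 hxR
    linarith
  have hd : Metric.ball (e x) r ⊆ chartDomain L E x₀ :=
    hsubR.trans ((Metric.ball_subset_ball hRu).trans hud)
  have hxb : e x ∈ Metric.ball (e x) r := Metric.mem_ball_self hr0
  have hyb : e y ∈ Metric.ball (e x) r := by
    rw [Metric.mem_ball, dist_eq_norm]
    have : κ * r < r := mul_lt_of_lt_one_left hr0 (by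
      have : Real.exp (-C) ≤ 1 := Real.exp_le_one_iff.2 (by linarith)
      rw [hκ]; linarith)
    linarith
  set F : E → ℂ := (fun x => coord L p x₀ x (s x)) ∘ e.symm with hF
  have hFd : DifferentiableOn ℂ F (Metric.ball (e x) r) :=
    (differentiableOn_comp_chart_symm (hs x₀) x₀).mono hd
  have hFn : ∀ w ∈ Metric.ball (e x) r, h.normPow p (e.symm w) (s (e.symm w)) =
      ‖F w‖ * Real.exp (-(p * h.potential x₀ w)) := fun w hw => h.normPow_chart s (hd hw)
  have hpair : ∀ q ∈ e.source, e q ∈ Metric.ball (e x) r →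
      h.normPow p q (s q) * Real.exp (-(p * f q)) =
        ‖F (e q)‖ * Real.exp (-(p * (f (e.symm (e q)) + h.potential x₀ (e q)))) := by
    intro q hq hqb
    have h1 := hFn (e q) hqb
    rw [e.left_inv hq] at h1
    rw [h1, e.left_inv hq, mul_assoc, ← Real.exp_add]
    congr 2
    ring
  have hholder : ∀ {k : X → ℝ} {A : ℝ}, A + Cu ≤ C →
      (∀ z ∈ Metric.ball (e x₀) R, ∀ w ∈ Metric.ball (e x₀) R,
        |k (e.symm z) - k (e.symm w)| ≤ A * ‖z - w‖ ^ β) →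
      ∀ w ∈ Metric.ball (e x) r, |(k (e.symm w) + h.potential x₀ w) -
        (k (e.symm (e x)) + h.potential x₀ (e x))| ≤ C * ‖w - e x‖ ^ β := by
    intro k A hA hk w hw
    have h1 := hk w (hsubR hw) (e x) (hsubR hxb)
    have h2 := huH w (Metric.ball_subset_ball hRu (hsubR hw)) (e x)
      (Metric.ball_subset_ball hRu (hsubR hxb))
    rw [add_sub_add_comm]
    calc _ ≤ A * ‖w - e x‖ ^ β + Cu * ‖w - e x‖ ^ β := (abs_add_le _ _).trans (add_le_add h1 h2)
      _ = (A + Cu) * ‖w - e x‖ ^ β := by ring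
      _ ≤ C * ‖w - e x‖ ^ β := by gcongr
  rw [hpair y hys hyb]
  rw [hpair x hxs hxb] at hxM
  have hPr : p * r ^ β ≤ 1 := by
    have h1 : r ^ β ≤ P ^ β :=
      Real.rpow_le_rpow hr0.le (mul_le_of_le_one_left hP0.le (by linarith)) hβ.le
    have h2 : P ^ β = (p : ℝ)⁻¹ := by
      rw [hP, ← Real.rpow_mul hp0.le, neg_mul, inv_mul_cancel₀ hβ.ne', Real.rpow_neg_one]
    calc p * r ^ β ≤ p * (p : ℝ)⁻¹ := by rw [← h2]; gcongr
      _ = 1 := mul_inv_cancel₀ hp0.ne'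
  have key := quarter_le_norm_mul_exp (u := fun z => g (e.symm z) + h.potential x₀ z)
    (v := fun z => f (e.symm z) + h.potential x₀ z) (C := C) hFd hr0 hM hp0.le hC0 hβ hPr ?_
    (hholder (A := Cg) (by linarith) fun z hz w hw => hgH g hg z (Metric.ball_subset_ball hRg hz) w
      (Metric.ball_subset_ball hRg hw))
    (hholder (A := Cf) (by linarith) fun z hz w hw => hfH f hf z (Metric.ball_subset_ball hRf hz) w
      (Metric.ball_subset_ball hRf hw)) ?_ hxM (hyx.trans hDr)
  · refine le_trans (le_of_eq ?_) key
    ring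
  · intro w hw
    have h1 := hsg (e.symm w)
    rw [hFn w hw, Real.exp_neg, ← div_eq_mul_inv, div_le_iff₀ (Real.exp_pos _), mul_assoc,
      ← Real.exp_add, ← mul_add] at h1
    exact h1
  · simp only [e.left_inv hxs]
    linarith [hgf x hxK]

variable [MeasurableSpace X] [BorelSpace X]

/-- The `L²` norm is bounded below by the measure of a set where the section is large. -/
lemma mul_rpow_le_l2Norm [T2Space X] [CompactSpace X] (hK : IsCompact K) {μ : Measure X}
    [IsProbabilityMeasure μ] (hμK : μ Kᶜ = 0) (hf : Continuous f) (hφf : EqOn φ f K) {p : ℕ}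
    {s : ∀ x, ⨂[ℂ]^p (L x)} (hs : IsHolomorphicSection L E s) {B : Set X} {m d : ℝ} (hm : 0 ≤ m)
    (hd : 0 ≤ d) (hB : ENNReal.ofReal d ≤ μ B)
    (hBm : ∀ y ∈ B, m ≤ h.normPow p y (s y) * Real.exp (-(p * f y))) :
    m * √d ≤ h.l2Norm K μ φ s := by
  set q : X → ℝ := fun y => h.normPow p y (s y) * Real.exp (-(p * f y)) with hq
  have hqc : Continuous q := (h.continuous_normPow hs).mul (by fun_prop)
  have hint : ∫ x in K, (h.normPow p x (s x) * Real.exp (-(p * φ x))) ^ 2 ∂μ =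
      ∫ x, q x ^ 2 ∂μ := by
    -- As `μ` charges only `K`, the integral may be taken over `X` with the continuous extension
    -- `f`; the ball `B` need not lie in `K`.
    rw [← Measure.restrict_eq_self_of_ae_mem (s := K) (μ := μ) (by rwa [ae_iff])]
    rw [Measure.restrict_restrict_of_subset subset_rfl]
    refine setIntegral_congr_fun hK.measurableSet fun x hx => ?_
    simp only [q, hφf hx]
  have hi : Integrable (fun x => q x ^ 2) μ :=
    (hqc.pow 2).integrable_of_hasCompactSupport (HasCompactSupport.of_compactSpace _)
  -- Chebyshev on a superlevel set containing `B`, so that `B` need not be measurable.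
  have hmarkov := mul_meas_ge_le_integral_of_nonneg (μ := μ)
    (Eventually.of_forall fun x => sq_nonneg (q x)) hi (m ^ 2)
  have hmeas : d ≤ μ.real {x | m ^ 2 ≤ q x ^ 2} := by
    rw [measureReal_def, ← ENNReal.ofReal_le_iff_le_toReal (measure_ne_top _ _)]
    refine hB.trans (measure_mono fun y hy => ?_)
    exact pow_le_pow_left₀ hm (hBm y hy) 2
  rw [l2Norm, hint]
  refine Real.le_sqrt_of_sq_le ?_
  rw [mul_pow, Real.sq_sqrt hd]
  exact (mul_le_mul_of_nonneg_left hmeas (sq_nonneg m)).trans hmarkov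

/-- A polynomial Bernstein-Markov inequality at almost maximal points near `x₀`. -/
lemma exists_le_mul_rpow_mul_l2Norm [FiniteDimensional ℂ E] [T2Space X] [CompactSpace X]
    [IsManifold 𝓘(ℂ, E) ω X]
    [ContMDiffVectorBundle ω ℂ L 𝓘(ℂ, E)] (h_pos : h.IsPositive) (hK : IsCompact K)
    {μ : Measure X} [IsProbabilityMeasure μ] (hμK : μ Kᶜ = 0) {β : ℝ} (hβ : 0 < β)
    (hβ1 : β ≤ 1) {α α' : ℝ} (hβα : β ≤ α) (hβα' : β ≤ α') {S T : Set (X → ℝ)}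
    (hS : IsBoundedHolder (E := E) α S) (hT : IsBoundedHolder (E := E) α' T) (hf : f ∈ S)
    (hg : g ∈ T) (hgf : ∀ x ∈ K, g x ≤ f x) (hφf : EqOn φ f K) {c ρ : ℝ} (hc : 0 < c)
    (hmass : ∀ x ∈ W, ∀ r : ℝ, 0 < r → r < 1 → ENNReal.ofReal (c * r ^ ρ) ≤ μ (h.ball x r))
    (x₀ : X) :
    ∃ U ∈ 𝓝 x₀, ∃ A > 0, ∀ p : ℕ, 1 ≤ p → ∀ s : ∀ x, ⨂[ℂ]^p (L x),
      IsHolomorphicSection L E s → ∀ M > 0,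
      (∀ z, h.normPow p z (s z) ≤ M * Real.exp (p * g z)) →
      ∀ x ∈ U, x ∈ W → x ∈ K → M / 2 ≤ h.normPow p x (s x) * Real.exp (-(p * f x)) →
      M ≤ A * (p : ℝ) ^ (ρ / (2 * β)) * h.l2Norm K μ φ s := by
  obtain ⟨U, hU, a, ha, ha1, b, hb, hmain⟩ :=
    h.exists_ball_quarter_le h_pos hβ hβ1 hβα hβα' hS hT hf hg hgf x₀
  refine ⟨U, hU, (b * √(c * a ^ ρ))⁻¹, by positivity, ?_⟩
  intro p hp s hs M hM hsg x hxU hxW hxK hxM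
  have hp1 : (1 : ℝ) ≤ p := by exact_mod_cast hp
  have hp0 : (0 : ℝ) < p := by linarith
  have hr0 : 0 < a * (p : ℝ) ^ (-β⁻¹) := by positivity
  have hP1 : (p : ℝ) ^ (-β⁻¹) ≤ 1 :=
    Real.rpow_le_one_of_one_le_of_nonpos hp1 (by simp [hβ.le])
  have hr1 : a * (p : ℝ) ^ (-β⁻¹) < 1 := (mul_le_of_le_one_right ha.le hP1).trans_lt ha1
  have key := h.mul_rpow_le_l2Norm hK hμK (hS.continuous hf) hφf hs (m := b * M)
    (d := c * (a * (p : ℝ) ^ (-β⁻¹)) ^ ρ) (by positivity) (by positivity)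
    (hmass x hxW _ hr0 hr1) (hmain p hp s hs M hM hsg x hxU hxK hxM)
  -- The square root turns the mass `p^{-ρ/β}` into the loss `p^{ρ/(2β)}`.
  have hsq : √(c * (a * (p : ℝ) ^ (-β⁻¹)) ^ ρ) =
      √(c * a ^ ρ) * ((p : ℝ) ^ (ρ / (2 * β)))⁻¹ := by
    rw [Real.mul_rpow ha.le (by positivity), ← mul_assoc, Real.sqrt_mul (by positivity),
      Real.sqrt_eq_rpow ((_ ^ _) ^ ρ), ← Real.rpow_mul hp0.le, ← Real.rpow_mul hp0.le,
      ← Real.rpow_neg hp0.le]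
    congr 2
    field_simp
  rw [hsq] at key
  have hpp : 0 < (p : ℝ) ^ (ρ / (2 * β)) := by positivity
  have hca : 0 < √(c * a ^ ρ) := by positivity
  calc M = (b * √(c * a ^ ρ))⁻¹ * (p : ℝ) ^ (ρ / (2 * β)) *
        (b * M * (√(c * a ^ ρ) * ((p : ℝ) ^ (ρ / (2 * β)))⁻¹)) := by field_simp
    _ ≤ _ := by gcongr

end Main

end HermitianMetric

end BernsteinMarkov

end

/-! ### Globalization over `W` and conclusion -/

theorem corollary2p10
    {E : Type*} [NormedAddCommGroup E] [NormedSpace ℂ E] [FiniteDimensional ℂ E]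
    {X : Type*} [TopologicalSpace X] [T2Space X] [CompactSpace X]
    [ChartedSpace E X] [IsManifold 𝓘(ℂ, E) ω X] [MeasurableSpace X] [BorelSpace X]
    {L : X → Type*} [∀ x, AddCommGroup (L x)] [∀ x, Module ℂ (L x)] [∀ x, TopologicalSpace (L x)]
    [TopologicalSpace (TotalSpace ℂ L)] [FiberBundle ℂ L] [VectorBundle ℂ ℂ L]
    [ContMDiffVectorBundle ω ℂ L 𝓘(ℂ, E)]
    (h₀ : BernsteinMarkov.HermitianMetric L E) (h_pos : h₀.IsPositive)
    (K W : Set X) (hK : IsCompact K) (hW : IsCompact W) (hWK : W ⊆ K)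
    (μ : Measure X) [IsProbabilityMeasure μ] (hμK : μ Kᶜ = 0)
    (α α' : ℝ) (hα : 0 < α) (hα' : 0 < α') (h_reg : h₀.IsRegular α α' K)
    (h_mass : h₀.MassDensity μ W)
    (φ : X → ℝ) (hφ : BernsteinMarkov.IsHolderOn E α K φ) (h_max : h₀.MaximumPrinciple W K φ) :
    h₀.IsOneBernsteinMarkov K φ μ := by
  intro δ hδ hδ1
  obtain ⟨c, hc, ρ, hρ, hmass⟩ := h_mass
  obtain ⟨T, hT, hTφ⟩ := h_reg.2 {φ} hφ
  obtain ⟨g, hgT, hg⟩ := hTφ φ rfl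
  obtain ⟨S, hS, hSφ⟩ := hφ
  obtain ⟨f, hfS, hφf⟩ := hSφ φ rfl
  have hgφ : ∀ x ∈ K, g x ≤ φ x := fun x hx => by
    have := h₀.equilibrium_le (h_reg.1 φ ⟨S, hS, hSφ⟩) hx
    rw [hg] at this
    exact_mod_cast this
  have hgf : ∀ x ∈ K, g x ≤ f x := fun x hx => hφf hx ▸ hgφ x hx
  have hf : Continuous f := hS.continuous hfS
  set β : ℝ := min (min α α') 1
  have hβ : 0 < β := by positivity
  have hβ1 : β ≤ 1 := min_le_right _ _
  have hβα : β ≤ α := (min_le_left _ _).trans (min_le_left _ _)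
  have hβα' : β ≤ α' := (min_le_left _ _).trans (min_le_right _ _)
  obtain ⟨A, hA, hmain⟩ : ∃ A > 0, ∀ p : ℕ, 1 ≤ p → ∀ s : ∀ x, ⨂[ℂ]^p (L x),
      BernsteinMarkov.IsHolomorphicSection L E s → ∀ M > 0,
      (∀ z, h₀.normPow p z (s z) ≤ M * Real.exp (p * g z)) →
      ∀ x ∈ W, x ∈ K → M / 2 ≤ h₀.normPow p x (s x) * Real.exp (-(p * f x)) →
      M ≤ A * (p : ℝ) ^ (ρ / (2 * β)) * h₀.l2Norm K μ φ s := by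
    -- Compactness of `W` turns the local constants into one valid for all `p`, all sections and all
    -- near-maximal points in `W`.
    refine hW.induction_on ⟨1, one_pos, by simp⟩ ?_ ?_ ?_
    · rintro s t hst ⟨A, hA, h⟩
      exact ⟨A, hA, fun p hp σ hσ M hM hg x hx => h p hp σ hσ M hM hg x (hst hx)⟩
    · rintro s t ⟨A, hA, h⟩ ⟨A', hA', h'⟩
      refine ⟨max A A', lt_max_of_lt_left hA, fun p hp σ hσ M hM hg x hx hxK hxM => ?_⟩
      have hl2 : 0 ≤ h₀.l2Norm K μ φ σ := Real.sqrt_nonneg _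
      rcases hx with hx | hx
      · refine (h p hp σ hσ M hM hg x hx hxK hxM).trans ?_
        gcongr
        exact le_max_left _ _
      · refine (h' p hp σ hσ M hM hg x hx hxK hxM).trans ?_
        gcongr
        exact le_max_right _ _
    · intro x₀ _
      obtain ⟨U, hU, A, hA, h⟩ := h₀.exists_le_mul_rpow_mul_l2Norm h_pos hK hμK hβ hβ1 hβα hβα' hS hT
        hfS hgT hgf hφf hc hmass x₀
      exact ⟨U ∩ W, inter_mem (mem_nhdsWithin_of_mem_nhds hU) self_mem_nhdsWithin, A, hA,
        fun p hp σ hσ M hM hg x hx => h p hp σ hσ M hM hg x hx.1 hx.2⟩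
  set N : ℝ := ρ / (2 * β)
  have hN : 0 ≤ N := by positivity
  have hη : 0 < 1 - δ := by linarith
  -- `N / (1 - δ)` is the constant in the exponent that dominates `p ^ N`; `A` is the prefactor.
  refine ⟨max A (N / (1 - δ)), lt_max_of_lt_left hA, fun p hp s hs => ?_⟩
  have hKne : K.Nonempty := by
    rw [nonempty_iff_ne_empty]
    rintro rfl
    simp at hμK
  have hp1 : (1 : ℝ) ≤ p := by exact_mod_cast hp
  have hqc : Continuous fun x => h₀.normPow p x (s x) * Real.exp (-(p * f x)) :=
    (h₀.continuous_normPow hs).mul (by fun_prop)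
  obtain ⟨x₁, hx₁, hmax⟩ := hK.exists_isMaxOn hKne hqc.continuousOn
  set M : ℝ := h₀.normPow p x₁ (s x₁) * Real.exp (-(p * f x₁)) with hM
  have hle : ∀ x ∈ K, h₀.normPow p x (s x) * Real.exp (-(p * φ x)) ≤ M := fun x hx => by
    rw [hφf hx]
    exact hmax hx
  have hsup : h₀.supNorm K φ s ≤ M := by
    have : Nonempty K := hKne.to_subtype
    exact ciSup_le fun x => hle x x.2
  have hl2 : 0 ≤ h₀.l2Norm K μ φ s := Real.sqrt_nonneg _
  refine hsup.trans ?_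
  have hM0 : 0 ≤ M := mul_nonneg (h₀.normPow_nonneg p x₁ (s x₁)) (Real.exp_pos _).le
  rcases hM0.eq_or_lt with h0 | hMpos
  · rw [← h0]
    positivity
  · obtain ⟨x, hxW, hxM⟩ := h_max.exists_half_le h₀ hp hs hMpos hx₁ (by rw [hφf hx₁])
    rw [hφf (hWK hxW)] at hxM
    have h1 := hmain p hp s hs M hMpos (h₀.normPow_le_exp_equilibrium hp hs hMpos hle hg) x hxW
      (hWK hxW) hxM
    refine h1.trans ?_
    have h2 := BernsteinMarkov.rpow_le_exp_mul_rpow hp1 hN hη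
    calc A * (p : ℝ) ^ N * h₀.l2Norm K μ φ s
        ≤ A * Real.exp (N / (1 - δ) * (p : ℝ) ^ (1 - δ)) * h₀.l2Norm K μ φ s := by gcongr
      _ ≤ _ := by
        gcongr
        · exact le_max_left _ _
        · exact le_max_right _ _
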